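/- Let $\Omega\subset\mathbb C$ be a domain, let $\lambda$ be Lebesgue measure and let $d\rho=\sigma\,d\lambda$ be a measure on $\Omega$ with a continuous density $\sigma:\Omega\to(0,\infty)$ such that all monomials $z^n$, $n\ge 0$, belong to $L^2(\Omega,\rho)$ (for example, $\Omega$ bounded and $\sigma=1$, or $\Omega=\mathbb C$ with a Gaussian density). Let $\mathcal B^2(\Omega,\rho)$ be the Bergman space of the analytic functions in $L^2(\Omega,\rho)$, and let $P(x,y)$ be its Bergman kernel, that is, $\overline{P(x,\cdot)}\in\mathcal B^2(\Omega,\rho)$ and $u(x)=\int_\Omega P(x,y)u(y)\,d\rho(y)$ for all $u\in\mathcal B^2(\Omega,\rho)$ and $x\in\Omega$. For a distribution $F\in\mathcal E'(\Omega)$ with compact support in $\Omega$ (a continuous linear functional on $C^\infty(\Omega)$), let $\mathcal T_F$ be the Bergman–Toeplitz operator $$(\mathcal T_F u)(x)=\langle F,P(x,\cdot)u(\cdot)\rangle,\qquad u\in\mathcal B^2(\Omega,\rho),\ x\in\Omega.$$ Suppose that $\mathcal T_F$ has finite rank $r$. Then there are distinct points $z_1,\dots,z_m\in\Omega$ with $m\le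 r$ and differential operators $L_1,\dots,L_m$ with constant complex coefficients in the real variables $x=\operatorname{Re}z$, $y=\operatorname{Im}z$, such that $$F=\sum_{j=1}^{m}L_j\,\delta(z-z_j).$$ In other words, $F$ is a finite linear combination of $\delta$-distributions at no more than $r$ points of $\Omega$ and of their derivatives. -/

import Mathlib

open MeasureTheory TopologicalSpace
open scoped ContDiff ComplexConjugate

noncomputable section

namespace FiniteRankToeplitz

/-- The space of complex-valued `C^∞` functions on the open set `Ω ⊆ ℂ = ℝ²`. A function on `Ω` is
represented by a function on `ℂ`; its values outside `Ω` are irrelevant. -/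
def Smooth (Ω : Opens ℂ) : Submodule ℂ (ℂ → ℂ) where
  carrier := {φ | ContDiffOn ℝ ∞ φ Ω}
  add_mem' := fun hf hg => ContDiffOn.add hf hg
  zero_mem' := contDiffOn_const
  smul_mem' := fun c _ hf => ContDiffOn.const_smul c hf

/-- Distributions with compact support in `Ω`, as the dual of the space `C^∞(Ω)`: linear
functionals `F` on `C^∞(Ω)` such that, for some compact `K ⊆ Ω` and some `N`, `C`,
`|⟨F, φ⟩| ≤ C * max_{k ≤ N} sup_K ‖D^k φ‖` for all `φ`. -/
structure CompactDistribution (Ω : Opens ℂ) where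
  /-- The action `φ ↦ ⟨F, φ⟩`. -/
  toLinearMap : Smooth Ω →ₗ[ℂ] ℂ
  /-- Continuity for the topology of `C^∞(Ω)`. -/
  continuity : ∃ K : Set ℂ, IsCompact K ∧ K ⊆ Ω ∧ ∃ (N : ℕ) (C : ℝ),
    ∀ (φ : Smooth Ω) (M : ℝ), 0 ≤ M →
      (∀ k ≤ N, ∀ z ∈ K, ‖iteratedFDeriv ℝ k (φ : ℂ → ℂ) z‖ ≤ M) →
      ‖toLinearMap φ‖ ≤ C * M

/-- The partial derivative `∂_x^a ∂_y^b φ`, where `z = x + i y`. -/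
def partialDeriv (a b : ℕ) (φ : ℂ → ℂ) : ℂ → ℂ :=
  (fun f z => fderiv ℝ f z 1)^[a] ((fun f z => fderiv ℝ f z Complex.I)^[b] φ)

/-- A differential operator `L = ∑ c_{ab} ∂_x^a ∂_y^b` with constant complex coefficients
(a finite sum), given by its coefficients `c_{ab}`. -/
abbrev DiffOp : Type := ℕ × ℕ →₀ ℂ

/-- The action of the distribution `L δ(· - w)` on a function `φ`:
`⟨∑ c_{ab} ∂_x^a ∂_y^b δ(· - w), φ⟩ = ∑ c_{ab} (-1)^(a+b) (∂_x^a ∂_y^b φ)(w)`. -/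
def DiffOp.delta (L : DiffOp) (w : ℂ) (φ : ℂ → ℂ) : ℂ :=
  L.sum fun ab c => c * (-1) ^ (ab.1 + ab.2) * partialDeriv ab.1 ab.2 φ w

/-- The measure `dρ = σ dλ` on `Ω`, where `λ` is Lebesgue measure. -/
def weighted (Ω : Opens ℂ) (σ : ℂ → ℝ) : Measure ℂ :=
  (volume.restrict (Ω : Set ℂ)).withDensity fun z => ENNReal.ofReal (σ z)

/-- The Bergman space of functions that are analytic in `Ω` and belong to `L²(Ω, ρ)`. The values
outside `Ω` are irrelevant, since `ρ` is carried by `Ω`. -/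
def Bergman (Ω : Opens ℂ) (σ : ℂ → ℝ) : Submodule ℂ (ℂ → ℂ) where
  carrier := {f | DifferentiableOn ℂ f Ω ∧ MemLp f 2 (weighted Ω σ)}
  add_mem' := fun hf hg => ⟨hf.1.add hg.1, hf.2.add hg.2⟩
  zero_mem' := ⟨differentiableOn_const 0, MemLp.zero⟩
  smul_mem' := fun c _ hf => ⟨hf.1.const_smul c, hf.2.const_smul c⟩

/-- `k` is the element of the Bergman space that represents evaluation at `x`:
`f(x) = (f, k) = ∫ f \bar k dρ` for all `f` in the Bergman space. The restriction of `k` to `Ω` is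
unique when `x ∈ Ω` and `σ` is continuous and positive on `Ω`. -/
def IsReproducingAt (Ω : Opens ℂ) (σ : ℂ → ℝ) (x : ℂ) (k : Bergman Ω σ) : Prop :=
  ∀ f : Bergman Ω σ, (f : ℂ → ℂ) x = ∫ y, (f : ℂ → ℂ) y * conj ((k : ℂ → ℂ) y) ∂(weighted Ω σ)

open Classical in
/-- The element of the Bergman space that represents evaluation at `x`. -/
def reproducing (Ω : Opens ℂ) (σ : ℂ → ℝ) (x : ℂ) : Bergman Ω σ :=
  if h : ∃ k, IsReproducingAt Ω σ x k then h.choose else 0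

/-- The Bergman kernel `P(x, y)`, the integral kernel with respect to `ρ` of the orthogonal
projection of `L²(Ω, ρ)` onto the Bergman space. -/
def kernel (Ω : Opens ℂ) (σ : ℂ → ℝ) (x y : ℂ) : ℂ :=
  conj ((reproducing Ω σ x : ℂ → ℂ) y)

theorem smooth_of_mem_bergman {Ω : Opens ℂ} {σ : ℂ → ℝ} {f : ℂ → ℂ} (hf : f ∈ Bergman Ω σ) :
    ContDiffOn ℝ ∞ f Ω :=
  (hf.1.contDiffOn Ω.isOpen).restrict_scalars ℝ

theorem kernel_mul_mem (Ω : Opens ℂ) (σ : ℂ → ℝ) (x : ℂ) (u : Bergman Ω σ) :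
    (fun y => kernel Ω σ x y * (u : ℂ → ℂ) y) ∈ Smooth Ω :=
  ContDiffOn.mul
    (Complex.conjCLE.contDiff.comp_contDiffOn
      (smooth_of_mem_bergman (reproducing Ω σ x).2))
    (smooth_of_mem_bergman u.2)

/-- The Bergman–Toeplitz operator with weight `F`, `(T_F u)(x) = ⟨F, P(x, ·) u(·)⟩` for `x ∈ Ω`.
The functions `T_F u` belong to the Bergman space, but for the rank of the operator it is
enough to regard them as functions on `Ω`. -/
def toeplitz {Ω : Opens ℂ} (σ : ℂ → ℝ) (F : CompactDistribution Ω) :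
    Bergman Ω σ →ₗ[ℂ] (Ω → ℂ) where
  toFun u x := F.toLinearMap ⟨fun y => kernel Ω σ x y * (u : ℂ → ℂ) y, kernel_mul_mem Ω σ x u⟩
  map_add' u v := by
    funext x
    rw [Pi.add_apply, ← map_add]
    congr 1
    ext y
    simp [mul_add]
  map_smul' c u := by
    funext x
    rw [Pi.smul_apply, RingHom.id_apply, ← map_smul]
    congr 1
    ext y
    simp [mul_left_comm]

end FiniteRankToeplitz

end

/-!
The proof reduces the claim to one on the complex-valued form `(u, w) ↦ ⟨F, u conj w⟩` on
holomorphic polynomials. Cauchy's estimates make a compactly supported distribution continuous on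
the Bergman space, which is complete by the mean value inequality; hence `w ↦ ⟨F, u conj w⟩` is
represented by an element of this space. Testing it on reproducing kernels shows that `T_F u = 0`
implies `⟨F, u conj w⟩ = 0` for all `w` (`functional_mul_star_eq_zero`), and so the form has rank at
most `r`. Conversely the numbers
`⟨F, z^j conj z^k⟩` determine `F`, since polynomials in `z` and `conj z` are dense in `C^∞(Ω)`
(`IsDistribution.eq_zero_of_monomials`).

The main step is that `F` is annihilated by a non-zero holomorphic polynomial
(`IsDistribution.exists_pol_annihilates`). Write the form as `∑ i, α_i(u) β_i(w)` with
`α_i(u) = ⟨F, u conj q_i⟩` and `β_i(w) = ⟨F, p_i conj w⟩`, where `p`, `q` are biorthogonal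
polynomials. The identity persists for polynomials times exponentials of polynomials. Hence, for
`h = z^k`, the `n × n` determinant of `⟨F, z^(m_j) conj q_l · e^{ζ h - conj (ζ h)}⟩` is the product
of `det (α_i(z^(m_j) e^{ζ h}))`, which is entire in `ζ`, and a factor which is antiholomorphic in `ζ`
and does not depend on `m`. The exponential has modulus one, so the determinant grows like
`|ζ|^(N n)` with `N` the order of `F`. After conjugation of the second factor, Liouville's theorem
applies to the product, an entire function; it is a polynomial in `ζ` of bounded degree. The
derivatives at `0` give a monic polynomial in the power sum `z_1^k + ⋯ + z_n^k` which annihilates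
the functional `p_1(z_1) ⋯ p_n(z_n) ↦ det (α_i(p_j))` (`exists_monic_psum_annihilates`). This
holds for every `k`, and Newton's identities turn it into a monic polynomial in each variable `z_i`
(`exists_monic_variable_annihilates`), which by biorthogonality annihilates `α_i`; the product of
these polynomials annihilates `F`.

The same holds for the conjugate of `F`, so that both `P` and `conj P` annihilate `F` for some
polynomial `P ≠ 0`. A partition of unity modulo `P` decomposes `F` into distributions annihilated by
powers of `z - a` and `conj (z - a)`, with `a` a root of `P` (`exists_decomposition`). These are
combinations of derivatives of the point mass at `a` (`IsDistribution.exists_eq_delta`). Those which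
do not vanish yield polynomials `p_a`, `q_a` such that `⟨F, p_a conj q_b⟩` is zero for `a ≠ b` and
non-zero for `a = b`, and therefore there are at most `r` of them (`card_le_rank_of_orthogonal`).
-/

open MeasureTheory TopologicalSpace
open scoped ContDiff ComplexConjugate

namespace FiniteRankToeplitz

open Filter Topology

/-! ### Distributions as functionals on a star algebra -/

/-- `C^∞(Ω)` as a star algebra: the same functions as `Smooth Ω`, with pointwise multiplication and
complex conjugation. -/
def smoothAlgebra (Ω : Opens ℂ) : StarSubalgebra ℂ (ℂ → ℂ) where
  carrier := {φ | ContDiffOn ℝ ∞ φ Ω}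
  mul_mem' := fun hf hg => ContDiffOn.mul hf hg
  add_mem' := fun hf hg => ContDiffOn.add hf hg
  algebraMap_mem' := fun _ => contDiffOn_const
  star_mem' := fun hf => Complex.conjCLE.contDiff.comp_contDiffOn hf

variable {Ω : Opens ℂ}

/-- A linear functional on `C^∞(Ω)` is a distribution with compact support when it is bounded by
finitely many derivatives on a compact subset of `Ω`. -/
def IsDistribution (Λ : smoothAlgebra Ω →ₗ[ℂ] ℂ) : Prop :=
  ∃ K : Set ℂ, IsCompact K ∧ K ⊆ Ω ∧ ∃ (N : ℕ) (C : ℝ), 0 ≤ C ∧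
    ∀ (φ : smoothAlgebra Ω) (M : ℝ), 0 ≤ M →
      (∀ k ≤ N, ∀ z ∈ K, ‖iteratedFDeriv ℝ k (φ : ℂ → ℂ) z‖ ≤ M) → ‖Λ φ‖ ≤ C * M

/-- The functional on the algebra `C^∞(Ω)` given by a compactly supported distribution. -/
def CompactDistribution.functional (F : CompactDistribution Ω) : smoothAlgebra Ω →ₗ[ℂ] ℂ where
  toFun φ := F.toLinearMap ⟨φ.1, φ.2⟩
  map_add' φ ψ := F.toLinearMap.map_add ⟨φ.1, φ.2⟩ ⟨ψ.1, ψ.2⟩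
  map_smul' c φ := F.toLinearMap.map_smul c ⟨φ.1, φ.2⟩

theorem CompactDistribution.isDistribution (F : CompactDistribution Ω) :
    IsDistribution F.functional := by
  obtain ⟨K, hK, hKΩ, N, C, h⟩ := F.continuity
  refine ⟨K, hK, hKΩ, N, |C|, abs_nonneg C, fun φ M hM hφ => ?_⟩
  exact (h ⟨φ.1, φ.2⟩ M hM hφ).trans (by gcongr; exact le_abs_self C)

/-! ### Bounds for derivatives -/

theorem norm_iteratedFDeriv_mul_le_of_le {f g : ℂ → ℂ} (hf : ContDiffOn ℝ ∞ f Ω)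
    (hg : ContDiffOn ℝ ∞ g Ω) {z : ℂ} (hz : z ∈ Ω) {N : ℕ} {A B : ℝ} (hA : 0 ≤ A)
    (hfA : ∀ k ≤ N, ‖iteratedFDeriv ℝ k f z‖ ≤ A) (hgB : ∀ k ≤ N, ‖iteratedFDeriv ℝ k g z‖ ≤ B)
    {k : ℕ} (hk : k ≤ N) : ‖iteratedFDeriv ℝ k (f * g) z‖ ≤ 2 ^ N * A * B := by
  have hB : 0 ≤ B := (norm_nonneg _).trans (hgB 0 (Nat.zero_le _))
  have h := norm_iteratedFDerivWithin_mul_le (𝕜 := ℝ) hf hg Ω.isOpen.uniqueDiffOn hz (n := k)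
    (by exact_mod_cast le_top)
  rw [iteratedFDerivWithin_of_isOpen k Ω.isOpen hz] at h
  refine h.trans ?_
  calc _ ≤ ∑ i ∈ Finset.range (k + 1), (k.choose i : ℝ) * A * B := by
        refine Finset.sum_le_sum fun i hi => ?_
        have hi' : i ≤ k := Nat.lt_succ_iff.mp (Finset.mem_range.mp hi)
        rw [iteratedFDerivWithin_of_isOpen i Ω.isOpen hz,
          iteratedFDerivWithin_of_isOpen (k - i) Ω.isOpen hz]
        gcongr
        · exact hfA i (hi'.trans hk)
        · exact hgB _ ((Nat.sub_le _ _).trans hk)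
    _ = 2 ^ k * A * B := by
        rw [← Finset.sum_mul, ← Finset.sum_mul]
        congr 2
        exact_mod_cast Nat.sum_range_choose k
    _ ≤ 2 ^ N * A * B := by
        gcongr
        norm_num

theorem exists_iteratedFDeriv_bound {f : ℂ → ℂ} (hf : ContDiffOn ℝ ∞ f Ω) {K : Set ℂ}
    (hK : IsCompact K) (hKΩ : K ⊆ Ω) (N : ℕ) :
    ∃ B : ℝ, 1 ≤ B ∧ ∀ k ≤ N, ∀ z ∈ K, ‖iteratedFDeriv ℝ k f z‖ ≤ B := by
  have h : ∀ k : ℕ, ∃ B : ℝ, ∀ z ∈ K, ‖iteratedFDeriv ℝ k f z‖ ≤ B := fun k => by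
    refine hK.exists_bound_of_continuousOn (ContinuousOn.mono ?_ hKΩ)
    exact (hf.continuousOn_iteratedFDerivWithin (m := k) (by exact_mod_cast le_top)
      Ω.isOpen.uniqueDiffOn).congr
      fun z hz => (iteratedFDerivWithin_of_isOpen k Ω.isOpen hz).symm
  choose B hB using h
  refine ⟨1 + ∑ k ∈ Finset.range (N + 1), |B k|, ?_, fun k hk z hz => ?_⟩
  · have : 0 ≤ ∑ k ∈ Finset.range (N + 1), |B k| := Finset.sum_nonneg fun _ _ => abs_nonneg _
    linarith
  · have h1 := Finset.single_le_sum (f := fun k => |B k|) (fun _ _ => abs_nonneg _)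
      (Finset.mem_range.mpr (Nat.lt_succ_iff.mpr hk))
    have h2 := hB k z hz
    have h3 := le_abs_self (B k)
    linarith

/-- The real derivatives of a holomorphic function are controlled by its complex ones. -/
theorem norm_iteratedFDeriv_le_of_differentiableOn {U : Set ℂ} (hU : IsOpen U) (k : ℕ) :
    ∀ {f : ℂ → ℂ}, DifferentiableOn ℂ f U → ∀ z ∈ U,
      ‖iteratedFDeriv ℝ k f z‖ ≤ ‖iteratedDeriv k f z‖ := by
  induction k with
  | zero => intro f _ z _; simp
  | succ k ih =>
    intro f hf z hz
    have hd : DifferentiableOn ℂ (deriv f) U := hf.deriv hU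
    let T : ℂ →L[ℝ] ℂ →L[ℝ] ℂ := ContinuousLinearMap.mul ℝ ℂ
    have h1 : fderiv ℝ f =ᶠ[𝓝 z] fun w => T (deriv f w) := by
      filter_upwards [hU.mem_nhds hz] with w hw
      have := ((hf.differentiableAt (hU.mem_nhds hw)).hasDerivAt.hasFDerivAt.restrictScalars
        ℝ).fderiv
      rw [this]
      ext x
      simp [T, mul_comm]
    have hs : ContDiffAt ℝ k (deriv f) z :=
      (((hd.contDiffOn (n := k) hU).restrict_scalars ℝ) z hz).contDiffAt (hU.mem_nhds hz)
    rw [← norm_iteratedFDeriv_fderiv, (h1.iteratedFDeriv ℝ k).eq_of_nhds, iteratedDeriv_succ']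
    calc _ ≤ ‖T‖ * ‖iteratedFDeriv ℝ k (deriv f) z‖ :=
          ContinuousLinearMap.norm_iteratedFDeriv_comp_left T hs le_rfl
      _ ≤ 1 * ‖iteratedDeriv k (deriv f) z‖ := by
          gcongr
          · exact ContinuousLinearMap.opNorm_mul_le ℝ ℂ
          · exact ih hd z hz
      _ = _ := one_mul _

/-- The composition of a smooth function with an entire function. -/
def comp (f : ℂ → ℂ) (hf : Differentiable ℂ f) (φ : smoothAlgebra Ω) : smoothAlgebra Ω :=
  ⟨fun z => f (φ.1 z), (hf.contDiff.restrict_scalars ℝ).comp_contDiffOn φ.2⟩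

theorem norm_iteratedFDeriv_comp_le_of_le {f : ℂ → ℂ} (hf : Differentiable ℂ f) {φ : ℂ → ℂ}
    (hφ : ContDiffOn ℝ ∞ φ Ω) {z : ℂ} (hz : z ∈ Ω) {k : ℕ} {C D : ℝ}
    (hC : ∀ i ≤ k, ‖iteratedDeriv i f (φ z)‖ ≤ C)
    (hD : ∀ i, 1 ≤ i → i ≤ k → ‖iteratedFDeriv ℝ i φ z‖ ≤ D ^ i) :
    ‖iteratedFDeriv ℝ k (fun w => f (φ w)) z‖ ≤ k.factorial * C * D ^ k := by
  have hf' : ContDiff ℝ ∞ f := hf.contDiff.restrict_scalars ℝ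
  have h := norm_iteratedFDerivWithin_comp_le (𝕜 := ℝ) (n := k) (x := z) (C := C) (D := D)
    hf'.contDiffOn hφ
    (by exact_mod_cast le_top) uniqueDiffOn_univ Ω.isOpen.uniqueDiffOn (Set.mapsTo_univ φ Ω) hz
    (fun i hi => by
      rw [iteratedFDerivWithin_univ]
      exact (norm_iteratedFDeriv_le_of_differentiableOn isOpen_univ i hf.differentiableOn _
        (Set.mem_univ _)).trans (hC i hi))
    (fun i h1 hi => by
      rw [iteratedFDerivWithin_of_isOpen i Ω.isOpen hz]
      exact hD i h1 hi)
  rwa [iteratedFDerivWithin_of_isOpen k Ω.isOpen hz] at h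

/-! ### Operations on distributions -/

namespace IsDistribution

variable {Λ Λ₁ Λ₂ : smoothAlgebra Ω →ₗ[ℂ] ℂ}

theorem mul_left (h : IsDistribution Λ) (g : smoothAlgebra Ω) :
    IsDistribution (Λ ∘ₗ LinearMap.mulLeft ℂ g) := by
  obtain ⟨K, hK, hKΩ, N, C, hC, hΛ⟩ := h
  obtain ⟨B, hB1, hB⟩ := exists_iteratedFDeriv_bound g.2 hK hKΩ N
  have hB0 : 0 ≤ B := zero_le_one.trans hB1
  refine ⟨K, hK, hKΩ, N, C * (2 ^ N * B), by positivity, fun φ M hM hφ => ?_⟩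
  rw [mul_assoc]
  exact hΛ (g * φ) _ (by positivity) fun k hk z hz =>
    norm_iteratedFDeriv_mul_le_of_le g.2 φ.2 (hKΩ hz) hB0
      (fun i hi => hB i hi z hz) (fun i hi => hφ i hi z hz) hk

theorem neg (h : IsDistribution Λ) : IsDistribution (-Λ) := by
  obtain ⟨K, hK, hKΩ, N, C, hC, hΛ⟩ := h
  exact ⟨K, hK, hKΩ, N, C, hC, fun φ M hM hφ => by
    rw [LinearMap.neg_apply, norm_neg]; exact hΛ φ M hM hφ⟩

theorem smul (h : IsDistribution Λ) (c : ℂ) : IsDistribution (c • Λ) := by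
  obtain ⟨K, hK, hKΩ, N, C, hC, hΛ⟩ := h
  refine ⟨K, hK, hKΩ, N, ‖c‖ * C, by positivity, fun φ M hM hφ => ?_⟩
  rw [LinearMap.smul_apply, norm_smul, mul_assoc]
  gcongr
  exact hΛ φ M hM hφ

theorem add (h₁ : IsDistribution Λ₁) (h₂ : IsDistribution Λ₂) : IsDistribution (Λ₁ + Λ₂) := by
  obtain ⟨K, hK, hKΩ, N, C, hC, hΛ⟩ := h₁
  obtain ⟨K', hK', hKΩ', N', C', hC', hΛ'⟩ := h₂
  refine ⟨K ∪ K', hK.union hK', Set.union_subset hKΩ hKΩ', max N N', C + C', by positivity,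
    fun φ M hM hφ => ?_⟩
  rw [LinearMap.add_apply, add_mul]
  exact (norm_add_le _ _).trans (add_le_add
    (hΛ φ M hM fun k hk z hz => hφ k (hk.trans (le_max_left _ _)) z (Or.inl hz))
    (hΛ' φ M hM fun k hk z hz => hφ k (hk.trans (le_max_right _ _)) z (Or.inr hz)))

theorem zero : IsDistribution (0 : smoothAlgebra Ω →ₗ[ℂ] ℂ) :=
  ⟨∅, isCompact_empty, Set.empty_subset _, 0, 0, le_rfl, fun _ _ _ _ => by simp⟩

theorem sum {ι : Type*} (s : Finset ι) {Λ : ι → smoothAlgebra Ω →ₗ[ℂ] ℂ}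
    (h : ∀ i ∈ s, IsDistribution (Λ i)) : IsDistribution (∑ i ∈ s, Λ i) :=
  Finset.sum_induction _ _ (fun _ _ => add) zero h

end IsDistribution

/-- The conjugate functional `φ ↦ conj ⟨Λ, conj φ⟩`. -/
noncomputable def conjFunctional (Λ : smoothAlgebra Ω →ₗ[ℂ] ℂ) : smoothAlgebra Ω →ₗ[ℂ] ℂ where
  toFun φ := conj (Λ (star φ))
  map_add' φ ψ := by simp
  map_smul' c φ := by simp [star_smul]

theorem conjFunctional_apply (Λ : smoothAlgebra Ω →ₗ[ℂ] ℂ) (φ : smoothAlgebra Ω) :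
    conjFunctional Λ φ = conj (Λ (star φ)) := rfl

theorem norm_iteratedFDeriv_star (φ : smoothAlgebra Ω) (k : ℕ) (z : ℂ) :
    ‖iteratedFDeriv ℝ k ((star φ : smoothAlgebra Ω) : ℂ → ℂ) z‖ =
      ‖iteratedFDeriv ℝ k (φ : ℂ → ℂ) z‖ :=
  LinearIsometryEquiv.norm_iteratedFDeriv_comp_left (𝕜 := ℝ) Complex.conjLIE (φ : ℂ → ℂ) z k

theorem IsDistribution.conj {Λ : smoothAlgebra Ω →ₗ[ℂ] ℂ} (h : IsDistribution Λ) :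
    IsDistribution (conjFunctional Λ) := by
  obtain ⟨K, hK, hKΩ, N, C, hC, hΛ⟩ := h
  refine ⟨K, hK, hKΩ, N, C, hC, fun φ M hM hφ => ?_⟩
  rw [conjFunctional_apply, RCLike.norm_conj]
  exact hΛ _ M hM fun k hk z hz => by
    rw [norm_iteratedFDeriv_star]; exact hφ k hk z hz

/-! ### Exponential functions -/

/-- The exponential of a smooth function. -/
noncomputable def expSmooth (φ : smoothAlgebra Ω) : smoothAlgebra Ω :=
  comp Complex.exp Complex.differentiable_exp φ

theorem expSmooth_add (φ ψ : smoothAlgebra Ω) :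
    expSmooth (φ + ψ) = expSmooth φ * expSmooth ψ := by
  ext z; exact Complex.exp_add _ _

theorem expSmooth_zero : expSmooth (0 : smoothAlgebra Ω) = 1 := by
  ext z; exact Complex.exp_zero

theorem star_expSmooth (φ : smoothAlgebra Ω) : star (expSmooth φ) = expSmooth (star φ) := by
  ext z; exact (Complex.exp_conj _).symm

/-- Cauchy's estimates turn uniform bounds for an entire function `f` into bounds for
`⟨Λ, g · (f ∘ φ)⟩`. -/
theorem IsDistribution.exists_bound_comp {Λ : smoothAlgebra Ω →ₗ[ℂ] ℂ} (h : IsDistribution Λ)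
    (g φ : smoothAlgebra Ω) :
    ∃ R C : ℝ, 0 ≤ R ∧ ∀ (f : ℂ → ℂ) (hf : Differentiable ℂ f) (ε : ℝ), 0 ≤ ε →
      (∀ w, ‖w‖ ≤ R → ‖f w‖ ≤ ε) → ‖Λ (g * comp f hf φ)‖ ≤ C * ε := by
  obtain ⟨K, hK, hKΩ, N, C, hC, hΛ⟩ := h.mul_left g
  obtain ⟨B, hB1, hB⟩ := exists_iteratedFDeriv_bound φ.2 hK hKΩ N
  have hB0 : 0 ≤ B := zero_le_one.trans hB1
  refine ⟨B + 1, C * (N.factorial * N.factorial * B ^ N), by positivity, fun f hf ε hε hfε => ?_⟩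
  rw [mul_assoc]
  refine hΛ (comp f hf φ) _ (by positivity) fun k hk z hz => ?_
  have hφz : ‖φ.1 z‖ ≤ B := by simpa using hB 0 (Nat.zero_le _) z hz
  refine (norm_iteratedFDeriv_comp_le_of_le (C := N.factorial * ε) (D := B) hf φ.2 (hKΩ hz)
    (fun i hi => ?_) fun i h1 hi =>
      (hB i (hi.trans hk) z hz).trans (le_self_pow₀ hB1 (by omega))).trans ?_
  · have h1 := Complex.norm_iteratedDeriv_le_of_forall_mem_sphere_norm_le (c := φ.1 z) (C := ε) i
      one_pos hf.diffContOnCl fun w hw => hfε w (by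
        have : ‖w - φ.1 z‖ = 1 := by simpa using hw
        calc ‖w‖ = ‖φ.1 z + (w - φ.1 z)‖ := by congr 1; ring
          _ ≤ B + 1 := (norm_add_le _ _).trans (by linarith))
    refine h1.trans ?_
    rw [one_pow, div_one]
    gcongr
    exact hi.trans hk
  · calc (k.factorial : ℝ) * (N.factorial * ε) * B ^ k
        ≤ N.factorial * (N.factorial * ε) * B ^ N := by gcongr
      _ = _ := by ring

/-- A distribution may be applied to the exponential series term by term. -/
theorem IsDistribution.hasSum_exp {Λ : smoothAlgebra Ω →ₗ[ℂ] ℂ} (h : IsDistribution Λ)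
    (g φ : smoothAlgebra Ω) :
    HasSum (fun n : ℕ => (n.factorial : ℂ)⁻¹ * Λ (g * φ ^ n)) (Λ (g * expSmooth φ)) := by
  obtain ⟨R, C, hR, hb⟩ := h.exists_bound_comp g φ
  have hterm : ∀ n : ℕ, (n.factorial : ℂ)⁻¹ * Λ (g * φ ^ n) =
      Λ (g * comp (fun w => (n.factorial : ℂ)⁻¹ * w ^ n) (by fun_prop) φ) := fun n => by
    rw [← smul_eq_mul, ← map_smul]
    congr 1
    ext z
    change (n.factorial : ℂ)⁻¹ * (g.1 z * (φ.1 z) ^ n) = g.1 z * ((n.factorial : ℂ)⁻¹ * φ.1 z ^ n)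
    ring
  have hsummable : Summable fun n : ℕ => (n.factorial : ℂ)⁻¹ * Λ (g * φ ^ n) := by
    refine Summable.of_norm_bounded (g := fun n => C * (R ^ n / n.factorial))
      ((Real.summable_pow_div_factorial R).mul_left C) fun n => ?_
    rw [hterm]
    refine hb _ _ _ (by positivity) fun w hw => ?_
    rw [norm_mul, norm_inv, norm_pow, RCLike.norm_natCast, div_eq_inv_mul]
    gcongr
  refine (hsummable.hasSum_iff_tendsto_nat).mpr ?_
  rw [tendsto_iff_norm_sub_tendsto_zero]
  have hR' : Tendsto (fun m => C * (Real.exp R - ∑ n ∈ Finset.range m, R ^ n / n.factorial))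
      atTop (𝓝 0) := by
    have h1 : Tendsto (fun m => ∑ n ∈ Finset.range m, R ^ n / n.factorial) atTop
        (𝓝 (Real.exp R)) := by
      rw [Real.exp_eq_exp_ℝ]
      exact (NormedSpace.expSeries_div_hasSum_exp (𝔸 := ℝ) R).tendsto_sum_nat
    simpa using (h1.const_sub (Real.exp R)).const_mul C
  refine squeeze_zero (fun _ => norm_nonneg _) (fun m => ?_) hR'
  have hm : Λ (g * expSmooth φ) - ∑ n ∈ Finset.range m, (n.factorial : ℂ)⁻¹ * Λ (g * φ ^ n) =
      Λ (g * comp (fun w => Complex.exp w - ∑ n ∈ Finset.range m, w ^ n / n.factorial)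
        (by fun_prop) φ) := by
    have : g * comp (fun w => Complex.exp w - ∑ n ∈ Finset.range m, w ^ n / n.factorial)
        (by fun_prop) φ = g * expSmooth φ -
          ∑ n ∈ Finset.range m, (n.factorial : ℂ)⁻¹ • (g * φ ^ n) := by
      ext z
      simp only [comp, expSmooth, MulMemClass.coe_mul, Pi.mul_apply, AddSubgroupClass.coe_sub,
        Pi.sub_apply, AddSubmonoidClass.coe_finsetSum, Finset.sum_apply, SetLike.val_smul,
        Pi.smul_apply, SubmonoidClass.coe_pow, Pi.pow_apply, smul_eq_mul, mul_sub, Finset.mul_sum]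
      congr 1
      refine Finset.sum_congr rfl fun n _ => ?_
      rw [div_eq_inv_mul]; ring
    rw [this, map_sub, map_sum]
    simp
  rw [norm_sub_rev, hm]
  refine hb _ _ _ ?_ fun w hw => ?_
  · rw [sub_nonneg]
    exact Real.sum_le_exp_of_nonneg hR m
  · refine (Complex.norm_exp_sub_sum_le_exp_norm_sub_sum w m).trans ?_
    -- the remainder of the exponential series is increasing on `[0, ∞)`
    have hw0 := norm_nonneg w
    have e1 := (NormedSpace.expSeries_div_hasSum_exp (𝔸 := ℝ) ‖w‖)
    have e2 := (NormedSpace.expSeries_div_hasSum_exp (𝔸 := ℝ) R)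
    rw [← Real.exp_eq_exp_ℝ] at e1 e2
    rw [← e1.tsum_eq, ← e2.tsum_eq, ← e1.summable.sum_add_tsum_nat_add m,
      ← e2.summable.sum_add_tsum_nat_add m, add_sub_cancel_left, add_sub_cancel_left]
    refine Summable.tsum_le_tsum (fun n => by gcongr) ?_ ?_
    · exact (summable_nat_add_iff m).mpr e1.summable
    · exact (summable_nat_add_iff m).mpr e2.summable

/-- `ζ ↦ ⟨Λ, g e^{ζφ}⟩` is entire and may be differentiated under the bracket. -/
theorem IsDistribution.hasDerivAt_exp {Λ : smoothAlgebra Ω →ₗ[ℂ] ℂ} (h : IsDistribution Λ)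
    (g φ : smoothAlgebra Ω) (ζ : ℂ) :
    HasDerivAt (fun ζ : ℂ => Λ (g * expSmooth (ζ • φ))) (Λ (g * φ * expSmooth (ζ • φ))) ζ := by
  let c : ℕ → ℂ := fun n => (n.factorial : ℂ)⁻¹ * Λ (g * expSmooth (ζ • φ) * φ ^ n)
  have hp : HasFPowerSeriesAt (fun ζ : ℂ => Λ (g * expSmooth (ζ • φ)))
      (FormalMultilinearSeries.ofScalars ℂ c) ζ := by
    rw [hasFPowerSeriesAt_iff]
    refine Eventually.of_forall fun t => ?_
    have h1 := h.hasSum_exp (g * expSmooth (ζ • φ)) (t • φ)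
    rw [mul_assoc, ← expSmooth_add, ← add_smul] at h1
    refine h1.congr_fun fun n => ?_
    simp only [FormalMultilinearSeries.coeff_ofScalars, c, smul_pow, mul_smul_comm, map_smul,
      smul_eq_mul]
    ring
  have h2 := hp.hasDerivAt
  rw [FormalMultilinearSeries.apply_eq_pow_smul_coeff,
    FormalMultilinearSeries.coeff_ofScalars] at h2
  simpa [c, mul_right_comm] using h2

/-- The Fourier-type transform `ζ ↦ ⟨Λ, g e^{ζφ - conj (ζφ)}⟩` has polynomial growth, of an order
which depends only on `Λ`, since the exponential is unimodular. -/
theorem IsDistribution.exists_polynomial_growth {Λ : smoothAlgebra Ω →ₗ[ℂ] ℂ}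
    (h : IsDistribution Λ) :
    ∃ N : ℕ, ∀ g φ : smoothAlgebra Ω, ∃ C : ℝ, ∀ ζ : ℂ,
      ‖Λ (g * expSmooth (ζ • φ - star (ζ • φ)))‖ ≤ C * (1 + ‖ζ‖) ^ N := by
  obtain ⟨K, hK, hKΩ, N, C, hC, hΛ⟩ := h
  refine ⟨N, fun g φ => ?_⟩
  obtain ⟨G, hG1, hG⟩ := exists_iteratedFDeriv_bound g.2 hK hKΩ N
  have hG0 : 0 ≤ G := zero_le_one.trans hG1
  obtain ⟨B, hB1, hB⟩ := exists_iteratedFDeriv_bound φ.2 hK hKΩ N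
  have hB0 : 0 ≤ B := zero_le_one.trans hB1
  refine ⟨C * (2 ^ N * G * (N.factorial * (2 * B) ^ N)), fun ζ => ?_⟩
  set ψ : smoothAlgebra Ω := ζ • φ - star (ζ • φ) with hψ
  have hD1 : 1 ≤ 2 * B * (1 + ‖ζ‖) := by nlinarith [norm_nonneg ζ]
  have key : ∀ k ≤ N, ∀ z ∈ K, ‖iteratedFDeriv ℝ k ((expSmooth ψ : smoothAlgebra Ω) : ℂ → ℂ) z‖ ≤
      N.factorial * (2 * B * (1 + ‖ζ‖)) ^ N := fun k hk z hz => by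
    refine (norm_iteratedFDeriv_comp_le_of_le (C := 1) (D := 2 * B * (1 + ‖ζ‖))
      Complex.differentiable_exp ψ.2 (hKΩ hz) (fun i hi => ?_) fun i h1 hi => ?_).trans ?_
    · have hre : (ψ.1 z).re = 0 := by
        change (ζ * φ.1 z - conj (ζ * φ.1 z)).re = 0
        simp
      rw [iteratedDeriv_eq_iterate, Complex.iter_deriv_exp, Complex.norm_exp, hre, Real.exp_zero]
    · refine le_trans ?_ (le_self_pow₀ hD1 (by omega))
      have hsm : ∀ χ : smoothAlgebra Ω, ContDiffAt ℝ i (χ : ℂ → ℂ) z := fun χ =>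
        ((χ.2 z (hKΩ hz)).contDiffAt (Ω.isOpen.mem_nhds (hKΩ hz))).of_le
          (by exact_mod_cast le_top)
      have hφi : ‖iteratedFDeriv ℝ i ((ζ • φ : smoothAlgebra Ω) : ℂ → ℂ) z‖ ≤ ‖ζ‖ * B := by
        have h1 : iteratedFDeriv ℝ i ((ζ • φ : smoothAlgebra Ω) : ℂ → ℂ) z =
            ζ • iteratedFDeriv ℝ i (φ : ℂ → ℂ) z := iteratedFDeriv_const_smul_apply (hsm φ)
        rw [h1, norm_smul]
        gcongr
        exact hB i (hi.trans hk) z hz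
      have h2 : iteratedFDeriv ℝ i ((ψ : smoothAlgebra Ω) : ℂ → ℂ) z =
          iteratedFDeriv ℝ i ((ζ • φ : smoothAlgebra Ω) : ℂ → ℂ) z -
            iteratedFDeriv ℝ i ((star (ζ • φ) : smoothAlgebra Ω) : ℂ → ℂ) z :=
        iteratedFDeriv_sub_apply (hsm _) (hsm _)
      rw [h2]
      refine (norm_sub_le _ _).trans ?_
      rw [norm_iteratedFDeriv_star]
      nlinarith [norm_nonneg ζ]
    · rw [mul_one]
      gcongr
  calc _ ≤ C * (2 ^ N * G * (N.factorial * (2 * B * (1 + ‖ζ‖)) ^ N)) :=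
        hΛ (g * expSmooth ψ) _ (by positivity) fun k hk z hz =>
          norm_iteratedFDeriv_mul_le_of_le g.2 (expSmooth ψ).2 (hKΩ hz) hG0
            (fun i hi => hG i hi z hz) (fun i hi => key i hi z hz) hk
    _ = _ := by rw [mul_pow (2 * B)]; ring

/-! ### Density of polynomials in `C^∞(Ω)` -/

open scoped Convolution in
/-- Convolution with a probability density `κ` changes the derivatives of a compactly supported
smooth function by at most a multiple of the first absolute moment of `κ`. -/
theorem norm_iteratedFDeriv_convolution_sub_le (k : ℕ) :
    ∀ {E : Type} [NormedAddCommGroup E] [NormedSpace ℝ E] [CompleteSpace E] {f : ℂ → E},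
      HasCompactSupport f → ContDiff ℝ ∞ f → ∃ L : ℝ, ∀ κ : ℂ → ℝ, (∀ w, 0 ≤ κ w) →
        Integrable κ → Integrable (fun w => κ w * ‖w‖) → ∫ w, κ w = 1 → ∀ z : ℂ,
          ‖iteratedFDeriv ℝ k
            (fun z => (κ ⋆[ContinuousLinearMap.lsmul ℝ ℝ, volume] f) z - f z) z‖ ≤
            L * ∫ w, κ w * ‖w‖ := by
  induction k with
  | zero =>
    intro E _ _ _ f hfc hf
    obtain ⟨L, hL⟩ := hf.lipschitzWith_of_hasCompactSupport hfc (by simp)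
    refine ⟨L, fun κ h0 hκ hκ' h1 z => ?_⟩
    rw [norm_iteratedFDeriv_zero, convolution_lsmul]
    obtain ⟨B, hB⟩ := hfc.exists_bound_of_continuous hf.continuous
    have hint : Integrable fun w => κ w • f (z - w) :=
      hκ.smul_bdd B (hf.continuous.comp (by fun_prop)).aestronglyMeasurable
        (Eventually.of_forall fun w => hB _)
    have hc : f z = ∫ w, κ w • f z := by rw [integral_smul_const, h1, one_smul]
    have hint' : Integrable fun w => κ w • f z := hκ.smul_const _
    rw [hc, ← integral_sub hint hint', ← integral_const_mul]
    refine norm_integral_le_of_norm_le (hκ'.const_mul _) (Eventually.of_forall fun w => ?_)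
    rw [← smul_sub, norm_smul, Real.norm_of_nonneg (h0 w)]
    have := hL.dist_le_mul (z - w) z
    rw [dist_eq_norm, dist_eq_norm, sub_sub_cancel_left, norm_neg] at this
    nlinarith [h0 w]
  | succ k ih =>
    intro E _ _ _ f hfc hf
    obtain ⟨L, hL⟩ := ih (hfc.fderiv ℝ) (hf.fderiv_right (m := ∞) (by simp))
    refine ⟨L, fun κ h0 hκ hκ' h1 z => ?_⟩
    rw [← norm_iteratedFDeriv_fderiv]
    convert hL κ h0 hκ hκ' h1 z using 3
    ext1 w
    have hd := hfc.hasFDerivAt_convolution_right (ContinuousLinearMap.lsmul ℝ ℝ)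
      hκ.locallyIntegrable (hf.of_le (by simp)) w
    have hd' := hd.sub ((hf.differentiable (by simp)) w).hasFDerivAt
    exact hd'.fderiv

/-- The coordinate function `z`. -/
def coord (Ω : Opens ℂ) : smoothAlgebra Ω := ⟨fun z => z, contDiffOn_id⟩

/-- The polynomials in `z` and `conj z`. -/
noncomputable def polyAlgebra (Ω : Opens ℂ) : Subalgebra ℂ (smoothAlgebra Ω) :=
  Algebra.adjoin ℂ {coord Ω, star (coord Ω)}

theorem coord_mem : coord Ω ∈ polyAlgebra Ω := Algebra.subset_adjoin (by simp)

theorem star_coord_mem : star (coord Ω) ∈ polyAlgebra Ω := Algebra.subset_adjoin (by simp)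

/-- Integrals against `(R ^ 2 - |z - w| ^ 2) ^ n` are polynomials in `z` and `conj z`, since the
weight is one, with coefficients depending on `w`. -/
theorem exists_integral_eq_poly (Ω : Opens ℂ) (R : ℝ) (n : ℕ) :
    ∀ f : ℂ → ℂ, Continuous f → HasCompactSupport f → ∃ P ∈ polyAlgebra Ω, ∀ z,
      (P : ℂ → ℂ) z = ∫ w, (((R ^ 2 - ‖z - w‖ ^ 2) ^ n : ℝ) : ℂ) * f w := by
  induction n with
  | zero =>
    intro f _ _
    refine ⟨algebraMap ℂ _ (∫ w, f w), Subalgebra.algebraMap_mem _ _, fun z => ?_⟩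
    simp only [pow_zero, Complex.ofReal_one, one_mul]
    rfl
  | succ n ih =>
    intro f hf hfc
    have hint : ∀ g : ℂ → ℂ, Continuous g → HasCompactSupport g → ∀ z : ℂ,
        Integrable fun w => (((R ^ 2 - ‖z - w‖ ^ 2) ^ n : ℝ) : ℂ) * g w := fun g hg hgc z =>
      (Continuous.mul (by fun_prop) hg).integrable_of_hasCompactSupport hgc.mul_left
    have c1 : Continuous fun w : ℂ => (((R ^ 2 : ℝ) : ℂ) - w * conj w) * f w := by fun_prop
    have s1 : HasCompactSupport fun w : ℂ => (((R ^ 2 : ℝ) : ℂ) - w * conj w) * f w := hfc.mul_left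
    have c2 : Continuous fun w : ℂ => conj w * f w := by fun_prop
    have s2 : HasCompactSupport fun w : ℂ => conj w * f w := hfc.mul_left
    have c3 : Continuous fun w : ℂ => w * f w := by fun_prop
    have s3 : HasCompactSupport fun w : ℂ => w * f w := hfc.mul_left
    obtain ⟨P1, hP1, h1⟩ := ih _ c1 s1
    obtain ⟨P2, hP2, h2⟩ := ih _ c2 s2
    obtain ⟨P3, hP3, h3⟩ := ih _ c3 s3
    obtain ⟨P4, hP4, h4⟩ := ih f hf hfc
    refine ⟨P1 + coord Ω * P2 + star (coord Ω) * P3 - coord Ω * star (coord Ω) * P4,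
      sub_mem (add_mem (add_mem hP1 (mul_mem coord_mem hP2)) (mul_mem star_coord_mem hP3))
        (mul_mem (mul_mem coord_mem star_coord_mem) hP4), fun z => ?_⟩
    change P1.1 z + z * P2.1 z + conj z * P3.1 z - z * conj z * P4.1 z = _
    have i2 := (hint _ c2 s2 z).const_mul z
    have i3 := (hint _ c3 s3 z).const_mul (conj z)
    have i4 := (hint _ hf hfc z).const_mul (z * conj z)
    have i12 := (hint _ c1 s1 z).add i2
    have i123 := i12.add i3
    rw [h1, h2, h3, h4, ← integral_const_mul, ← integral_const_mul, ← integral_const_mul,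
      ← integral_add (hint _ c1 s1 z) i2]
    refine (congrArg₂ _ (integral_add i12 i3).symm rfl).trans ?_
    refine (integral_sub i123 i4).symm.trans ?_
    refine integral_congr_ae (Eventually.of_forall fun w => ?_)
    have hn : ((‖z - w‖ ^ 2 : ℝ) : ℂ) = (z - w) * (conj z - conj w) := by
      rw [← map_sub, Complex.mul_conj, Complex.normSq_eq_norm_sq]
    simp only [Pi.add_apply, pow_succ _ n, Complex.ofReal_mul, Complex.ofReal_sub, hn]
    ring

/-- A Landau kernel on a large disc: convolution with it turns functions supported in a smaller
disc into polynomials. -/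
theorem exists_landau_kernel {R : ℝ} (hR : 0 < R) {ε : ℝ} (hε : 0 < ε) :
    ∃ (n : ℕ) (c : ℝ), let κ : ℂ → ℝ :=
        (Metric.closedBall 0 R).indicator fun w => c * (R ^ 2 - ‖w‖ ^ 2) ^ n
      (∀ w, 0 ≤ κ w) ∧ Integrable κ ∧ Integrable (fun w => κ w * ‖w‖) ∧ ∫ w, κ w = 1 ∧
        ∫ w, κ w * ‖w‖ ≤ ε := by
  set s : Set ℂ := Metric.closedBall 0 R with hs
  have hsc : IsCompact s := isCompact_closedBall _ _
  have hsm : MeasurableSet s := Metric.isClosed_closedBall.measurableSet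
  have hcs : ∀ w ∈ s, 0 ≤ R ^ 2 - ‖w‖ ^ 2 := fun w hw => by
    have : ‖w‖ ≤ R := by simpa [hs] using hw
    nlinarith [norm_nonneg w]
  have ht := tendsto_setIntegral_pow_smul_of_unique_maximum_of_isCompact_of_continuousOn
    (μ := (volume : Measure ℂ)) (x₀ := (0 : ℂ)) (c := fun w => R ^ 2 - ‖w‖ ^ 2)
    (g := fun w => ‖w‖) hsc (by fun_prop)
    (fun y _ hy => by have := norm_pos_iff.mpr hy; simp; positivity) hcs (by simp; positivity)
    (by rw [hs, interior_closedBall _ hR.ne']; exact subset_closure (by simpa using hR))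
    (by fun_prop)
  simp only [norm_zero, smul_eq_mul] at ht
  obtain ⟨n, hn⟩ := (ht.eventually (ge_mem_nhds hε)).exists
  have hI : ∀ g : ℂ → ℝ, Continuous g → Integrable (s.indicator g) := fun g hg =>
    (integrable_indicator_iff hsm).mpr (hg.continuousOn.integrableOn_compact hsc)
  have hpos : 0 < ∫ w in s, (R ^ 2 - ‖w‖ ^ 2) ^ n := by
    rw [setIntegral_pos_iff_support_of_nonneg_ae]
    · refine lt_of_lt_of_le (Metric.measure_ball_pos volume (0 : ℂ) hR) (measure_mono ?_)
      intro w hw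
      have hw' : ‖w‖ < R := by simpa using hw
      refine ⟨(pow_pos ?_ n).ne', Metric.ball_subset_closedBall hw⟩
      nlinarith [norm_nonneg w]
    · exact (ae_restrict_iff' hsm).mpr (Eventually.of_forall fun w hw => pow_nonneg (hcs w hw) n)
    · exact ContinuousOn.integrableOn_compact hsc (by fun_prop)
  set c := (∫ w in s, (R ^ 2 - ‖w‖ ^ 2) ^ n)⁻¹ with hc
  have hmul : (fun w => s.indicator (fun w => c * (R ^ 2 - ‖w‖ ^ 2) ^ n) w * ‖w‖) =
      s.indicator fun w => c * ((R ^ 2 - ‖w‖ ^ 2) ^ n * ‖w‖) := by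
    ext w
    by_cases hw : w ∈ s <;> simp [hw, mul_assoc]
  refine ⟨n, c, fun w => ?_, hI _ (by fun_prop), ?_, ?_, ?_⟩
  · refine Set.indicator_nonneg (fun w hw => ?_) w
    exact mul_nonneg (inv_nonneg.mpr hpos.le) (pow_nonneg (hcs w hw) n)
  · rw [hmul]; exact hI _ (by fun_prop)
  · rw [integral_indicator hsm, integral_const_mul, hc, inv_mul_cancel₀ hpos.ne']
  · rw [hmul, integral_indicator hsm, integral_const_mul]; exact hn

open scoped Convolution in
/-- Weierstrass approximation together with derivatives of order at most `N`. -/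
theorem exists_poly_approx {f : ℂ → ℂ} (hf : ContDiff ℝ ∞ f) (hfc : HasCompactSupport f)
    {K : Set ℂ} (hK : IsCompact K) (N : ℕ) {ε : ℝ} (hε : 0 < ε) :
    ∃ P ∈ polyAlgebra Ω, ∀ k ≤ N, ∀ z ∈ K,
      ‖iteratedFDeriv ℝ k (fun z => (P : ℂ → ℂ) z - f z) z‖ ≤ ε := by
  obtain ⟨ρ, hρ0, hρ⟩ := (hK.union hfc.isCompact).isBounded.subset_ball_lt 0 0
  have hL := fun k => norm_iteratedFDeriv_convolution_sub_le k hfc hf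
  choose L hL using hL
  set M : ℝ := 1 + ∑ k ∈ Finset.range (N + 1), |L k| with hM
  have hsum : ∀ k ≤ N, L k ≤ M := fun k hk => by
    have h1 := Finset.single_le_sum (f := fun k => |L k|) (fun _ _ => abs_nonneg _)
      (Finset.mem_range.mpr (Nat.lt_succ_iff.mpr hk))
    linarith [le_abs_self (L k)]
  have hM0 : 0 < M := by
    have : 0 ≤ ∑ k ∈ Finset.range (N + 1), |L k| := Finset.sum_nonneg fun _ _ => abs_nonneg _
    linarith
  obtain ⟨n, c, h0, hκ, hκ', h1, hle⟩ :=
    exists_landau_kernel (R := 2 * ρ) (by positivity) (div_pos hε hM0)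
  set κ : ℂ → ℝ :=
    (Metric.closedBall 0 (2 * ρ)).indicator fun w => c * ((2 * ρ) ^ 2 - ‖w‖ ^ 2) ^ n with hκdef
  obtain ⟨P, hP, hPeq⟩ := exists_integral_eq_poly Ω (2 * ρ) n (fun w => (c : ℂ) * f w)
    (continuous_const.mul hf.continuous) hfc.mul_left
  have hconv : ∀ z ∈ Metric.ball (0 : ℂ) ρ,
      (P : ℂ → ℂ) z = (κ ⋆[ContinuousLinearMap.lsmul ℝ ℝ, volume] f) z := fun z hz => by
    rw [hPeq, convolution_lsmul_swap]
    refine integral_congr_ae (Eventually.of_forall fun w => ?_)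
    by_cases hw : w ∈ tsupport f
    · have hw' := hρ (Or.inr hw)
      have hzw : z - w ∈ Metric.closedBall (0 : ℂ) (2 * ρ) := by
        rw [mem_closedBall_zero_iff]
        rw [mem_ball_zero_iff] at hz hw'
        linarith [norm_sub_le z w]
      simp only [hκdef, Set.indicator_of_mem hzw, Complex.real_smul]
      push_cast
      ring
    · simp [image_eq_zero_of_notMem_tsupport hw]
  refine ⟨P, hP, fun k hk z hz => ?_⟩
  have heq : (fun z => (P : ℂ → ℂ) z - f z) =ᶠ[𝓝 z]
      fun z => (κ ⋆[ContinuousLinearMap.lsmul ℝ ℝ, volume] f) z - f z := by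
    filter_upwards [Metric.isOpen_ball.mem_nhds (hρ (Or.inl hz))] with w hw
    rw [hconv w hw]
  rw [(heq.iteratedFDeriv ℝ k).eq_of_nhds]
  refine (hL k κ h0 hκ hκ' h1 z).trans ?_
  have hnn : 0 ≤ ∫ w, κ w * ‖w‖ := integral_nonneg fun w => mul_nonneg (h0 w) (norm_nonneg w)
  calc L k * ∫ w, κ w * ‖w‖ ≤ M * (ε / M) := by
        gcongr
        exact hsum k hk
    _ = ε := by field_simp

theorem exists_cutoff {K : Set ℂ} (hK : IsCompact K) (hKΩ : K ⊆ Ω) :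
    ∃ χ : ℂ → ℂ, ContDiff ℝ ∞ χ ∧ HasCompactSupport χ ∧ tsupport χ ⊆ Ω ∧
      ∀ z ∈ K, χ =ᶠ[𝓝 z] 1 := by
  obtain ⟨t, ht, hKt, htΩ⟩ := exists_compact_between hK Ω.isOpen hKΩ
  obtain ⟨χ, h1, h0, -⟩ := exists_contMDiffMap_one_nhds_of_subset_interior (n := (⊤ : ℕ∞))
    (modelWithCornersSelf ℝ ℂ) hK.isClosed hKt
  have hsupp : tsupport (fun z => (χ z : ℂ)) ⊆ t := by
    refine closure_minimal (fun z hz => ?_) ht.isClosed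
    by_contra hzt
    exact hz (by simp [h0 z hzt])
  refine ⟨fun z => (χ z : ℂ), Complex.ofRealCLM.contDiff.comp χ.contMDiff.contDiff,
    ht.of_isClosed_subset (isClosed_tsupport _) hsupp, hsupp.trans htΩ, fun z hz => ?_⟩
  rw [eventually_nhdsSet_iff_forall] at h1
  filter_upwards [h1 z hz] with w hw
  simp [hw]

theorem contDiff_mul_of_tsupport_subset {χ φ : ℂ → ℂ} (hχ : ContDiff ℝ ∞ χ)
    (hs : tsupport χ ⊆ Ω) (hφ : ContDiffOn ℝ ∞ φ Ω) : ContDiff ℝ ∞ (χ * φ) := by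
  rw [contDiff_iff_contDiffAt]
  intro z
  by_cases hz : z ∈ tsupport χ
  · exact hχ.contDiffAt.mul ((hφ z (hs hz)).contDiffAt (Ω.isOpen.mem_nhds (hs hz)))
  · have : (χ * φ) =ᶠ[𝓝 z] fun _ => 0 := by
      filter_upwards [(isClosed_tsupport χ).isOpen_compl.mem_nhds hz] with w hw
      simp [image_eq_zero_of_notMem_tsupport hw]
    exact contDiffAt_const.congr_of_eventuallyEq this

/-- A compactly supported distribution which vanishes on all polynomials in `z` and `conj z` is
zero. -/
theorem IsDistribution.eq_zero_of_polyAlgebra {Λ : smoothAlgebra Ω →ₗ[ℂ] ℂ}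
    (h : IsDistribution Λ) (hp : ∀ P ∈ polyAlgebra Ω, Λ P = 0) : Λ = 0 := by
  obtain ⟨K, hK, hKΩ, N, C, hC, hΛ⟩ := h
  ext φ
  obtain ⟨χ, hχ, hχc, hχs, hχ1⟩ := exists_cutoff hK hKΩ
  have hf : ContDiff ℝ ∞ (χ * (φ : ℂ → ℂ)) := contDiff_mul_of_tsupport_subset hχ hχs φ.2
  refine norm_le_zero_iff.mp (le_of_forall_pos_le_add fun ε hε => ?_)
  obtain ⟨P, hP, hPf⟩ := exists_poly_approx (Ω := Ω) hf hχc.mul_right hK N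
    (ε := ε / (C + 1)) (by positivity)
  have h1 : ‖Λ (P - φ)‖ ≤ C * (ε / (C + 1)) := hΛ _ _ (by positivity) fun k hk z hz => by
    have : ((P - φ : smoothAlgebra Ω) : ℂ → ℂ) =ᶠ[𝓝 z]
        fun z => (P : ℂ → ℂ) z - (χ * (φ : ℂ → ℂ)) z := by
      filter_upwards [hχ1 z hz] with w hw
      simp [hw]
    rw [(this.iteratedFDeriv ℝ k).eq_of_nhds]
    exact hPf k hk z hz
  rw [map_sub, hp P hP, zero_sub, norm_neg] at h1
  refine h1.trans ?_
  rw [zero_add, mul_div_assoc', div_le_iff₀ (by positivity)]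
  nlinarith

theorem eq_zero_on_adjoin_pair {A : Type*} [CommRing A] [Algebra ℂ A] (Λ : A →ₗ[ℂ] ℂ) {x y : A}
    (h : ∀ j k : ℕ, Λ (x ^ j * y ^ k) = 0) : ∀ a ∈ Algebra.adjoin ℂ {x, y}, Λ a = 0 := by
  intro a ha
  rw [← Subalgebra.mem_toSubmodule, Algebra.adjoin_eq_span] at ha
  induction ha using Submodule.span_induction with
  | mem a ha =>
    obtain ⟨j, k, rfl⟩ := (Submonoid.mem_closure_pair _ _ _).mp ha
    exact h j k
  | zero => exact map_zero Λ
  | add a b _ _ ha hb => rw [map_add, ha, hb, add_zero]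
  | smul c a _ ha => rw [map_smul, ha, smul_zero]

theorem IsDistribution.eq_zero_of_monomials {Λ : smoothAlgebra Ω →ₗ[ℂ] ℂ}
    (h : IsDistribution Λ) (hp : ∀ j k : ℕ, Λ (coord Ω ^ j * star (coord Ω) ^ k) = 0) : Λ = 0 :=
  h.eq_zero_of_polyAlgebra (eq_zero_on_adjoin_pair Λ hp)

/-! ### The Bergman space and its reproducing kernel -/

theorem enorm_center_le_lintegral_circle {f : ℂ → ℂ} {c : ℂ} {r : ℝ} (hr : 0 < r)
    (hf : DifferentiableOn ℂ f (Metric.closedBall c r)) :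
    ENNReal.ofReal (2 * Real.pi) * ‖f c‖ₑ ≤
      ∫⁻ θ in Set.Ioo (-Real.pi) Real.pi, ‖f (circleMap c r θ)‖ₑ := by
  have h1 : Real.circleAverage f c r = f c :=
    (hf.mono (by rw [abs_of_pos hr, closure_ball _ hr.ne'])).diffContOnCl.circleAverage
  rw [Real.circleAverage_eq_integral_add (-Real.pi),
    intervalIntegral.integral_comp_add_right (fun θ => f (circleMap c r θ)),
    show 0 + -Real.pi = -Real.pi by ring, show 2 * Real.pi + -Real.pi = Real.pi by ring,
    intervalIntegral.integral_of_le (by linarith [Real.pi_pos])] at h1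
  have h2 : ∫ θ in Set.Ioc (-Real.pi) Real.pi, f (circleMap c r θ) = (2 * Real.pi) • f c := by
    rw [← h1, smul_smul, mul_inv_cancel₀ (by positivity), one_smul]
  have h3 := enorm_integral_le_lintegral_enorm (μ := volume.restrict (Set.Ioc (-Real.pi) Real.pi))
    fun θ => f (circleMap c r θ)
  rw [h2, enorm_smul, Real.enorm_eq_ofReal (by positivity), ← restrict_Ioo_eq_restrict_Ioc] at h3
  exact h3

/-- The area mean value inequality, with a constant which is not sharp. -/
theorem enorm_center_le_lintegral_ball {f : ℂ → ℂ} {c : ℂ} {R : ℝ} (hR : 0 < R)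
    (hf : DifferentiableOn ℂ f (Metric.ball c R)) :
    ENNReal.ofReal (Real.pi * R ^ 2 / 2) * ‖f c‖ₑ ≤ ∫⁻ z in Metric.ball c R, ‖f z‖ₑ := by
  classical
  set g : ℂ → ENNReal := (Metric.ball 0 R).indicator fun w => ‖f (c + w)‖ₑ with hg
  have hgm : Measurable g := by
    rw [hg, ← Set.piecewise_eq_indicator]
    refine ContinuousOn.measurable_piecewise ?_ continuousOn_const measurableSet_ball
    refine ContinuousOn.enorm (hf.continuousOn.comp (by fun_prop) fun w hw => ?_)
    simpa using hw
  have e1 : ∫⁻ z in Metric.ball c R, ‖f z‖ₑ = ∫⁻ w, g w := by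
    rw [← lintegral_indicator measurableSet_ball, ← lintegral_add_left_eq_self _ c]
    congr 1
    ext w
    by_cases hw : ‖w‖ < R <;> simp [hg, hw]
  set S : Set (ℝ × ℝ) := Set.Ioo (R / 2) R ×ˢ Set.Ioo (-Real.pi) Real.pi with hS
  have hSt : S ⊆ polarCoord.target := by
    rintro ⟨r, θ⟩ ⟨h1, h2⟩
    exact ⟨lt_trans (by positivity) h1.1, h2⟩
  rw [e1, ← Complex.lintegral_comp_polarCoord_symm]
  -- in polar coordinates, only the radii in `(R / 2, R)` are used
  refine le_trans ?_ (lintegral_mono_set hSt)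
  have hmeas : Measurable fun p : ℝ × ℝ => ENNReal.ofReal p.1 • g (Complex.polarCoord.symm p) := by
    simp only [smul_eq_mul]
    refine (ENNReal.measurable_ofReal.comp measurable_fst).mul (hgm.comp ?_)
    rw [funext Complex.polarCoord_symm_apply]
    fun_prop
  rw [hS, Measure.volume_eq_prod, setLIntegral_prod _ hmeas.aemeasurable]
  calc ENNReal.ofReal (Real.pi * R ^ 2 / 2) * ‖f c‖ₑ
      = ∫⁻ _ in Set.Ioo (R / 2) R, ENNReal.ofReal (R / 2) *
          (ENNReal.ofReal (2 * Real.pi) * ‖f c‖ₑ) := by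
        rw [setLIntegral_const, Real.volume_Ioo, ← mul_assoc, mul_right_comm,
          ← ENNReal.ofReal_mul (by positivity), ← ENNReal.ofReal_mul (by positivity)]
        congr 2
        ring
    _ ≤ _ := by
        refine setLIntegral_mono' measurableSet_Ioo fun r hr => ?_
        have hr0 : 0 < r := lt_trans (by positivity) hr.1
        have hin : ∀ θ : ℝ, g (Complex.polarCoord.symm (r, θ)) = ‖f (circleMap c r θ)‖ₑ := fun θ => by
          have h1 : Complex.polarCoord.symm (r, θ) ∈ Metric.ball (0 : ℂ) R := by
            rw [mem_ball_zero_iff, Complex.norm_polarCoord_symm, abs_of_pos hr0]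
            exact hr.2
          rw [hg, Set.indicator_of_mem h1, Complex.polarCoord_symm_apply, circleMap,
            Complex.exp_mul_I, Complex.ofReal_cos, Complex.ofReal_sin]
        simp only [hin, smul_eq_mul]
        rw [lintegral_const_mul' _ _ ENNReal.ofReal_ne_top]
        gcongr
        · exact hr.1.le
        · exact enorm_center_le_lintegral_circle hr0
            (hf.mono (Metric.closedBall_subset_ball hr.2))

/-- The norm of the Bergman space. -/
noncomputable def bergmanNorm (Ω : Opens ℂ) (σ : ℂ → ℝ) (v : ℂ → ℂ) : ℝ :=
  (eLpNorm v 2 (weighted Ω σ)).toReal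

theorem bergmanNorm_nonneg (Ω : Opens ℂ) (σ : ℂ → ℝ) (v : ℂ → ℂ) : 0 ≤ bergmanNorm Ω σ v :=
  ENNReal.toReal_nonneg

theorem smul_restrict_ball_le_weighted {σ : ℂ → ℝ} {B : Set ℂ} (hB : MeasurableSet B)
    (hBΩ : B ⊆ Ω) {s : ℝ} (hs : ∀ z ∈ B, s ≤ σ z) :
    ENNReal.ofReal s • volume.restrict B ≤ weighted Ω σ := by
  refine Measure.le_iff.mpr fun A hA => ?_
  rw [weighted, withDensity_apply _ hA, Measure.restrict_restrict hA, Measure.smul_apply,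
    Measure.restrict_apply hA, smul_eq_mul, ← setLIntegral_const]
  calc _ ≤ ∫⁻ z in A ∩ B, ENNReal.ofReal (σ z) :=
        setLIntegral_mono' (hA.inter hB) fun z hz => ENNReal.ofReal_le_ofReal (hs z hz.2)
    _ ≤ _ := lintegral_mono_set (Set.inter_subset_inter_right A hBΩ)

/-- The `L²` norm of a holomorphic function controls its values on compact sets. -/
theorem exists_norm_le_bergmanNorm {σ : ℂ → ℝ} (hσ : ContinuousOn σ Ω) (hσ_pos : ∀ z ∈ Ω, 0 < σ z)
    {K : Set ℂ} (hK : IsCompact K) (hKΩ : K ⊆ Ω) :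
    ∃ C : ℝ, 0 ≤ C ∧ ∀ v ∈ Bergman Ω σ, ∀ z ∈ K, ‖v z‖ ≤ C * bergmanNorm Ω σ v := by
  obtain ⟨δ, hδ, hδΩ⟩ := hK.exists_cthickening_subset_open Ω.isOpen hKΩ
  have hKδ : IsCompact (Metric.cthickening δ K) := hK.cthickening
  obtain ⟨s, hs0, hs⟩ : ∃ s : ℝ, 0 < s ∧ ∀ z ∈ Metric.cthickening δ K, s ≤ σ z := by
    rcases (Metric.cthickening δ K).eq_empty_or_nonempty with he | hne
    · exact ⟨1, one_pos, by simp [he]⟩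
    · obtain ⟨w, hw, hmin⟩ := hKδ.exists_isMinOn hne (hσ.mono hδΩ)
      exact ⟨σ w, hσ_pos w (hδΩ hw), fun z hz => hmin hz⟩
  set c : ℝ := s * (Real.pi * δ ^ 2 / 2) with hc
  have hc0 : 0 < c := by positivity
  refine ⟨Real.sqrt c⁻¹, Real.sqrt_nonneg _, fun v hv z hz => ?_⟩
  have hball : Metric.ball z δ ⊆ Metric.cthickening δ K :=
    Metric.ball_subset_closedBall.trans (Metric.closedBall_subset_cthickening hz δ)
  have hv2 : DifferentiableOn ℂ (fun w => v w ^ 2) (Metric.ball z δ) :=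
    (hv.1.mono (hball.trans hδΩ)).pow 2
  have h1 := enorm_center_le_lintegral_ball hδ hv2
  have h2 : ENNReal.ofReal s * ∫⁻ w in Metric.ball z δ, ‖v w ^ 2‖ₑ ≤
      ∫⁻ w, ‖v w ^ 2‖ₑ ∂(weighted Ω σ) := by
    rw [← smul_eq_mul, ← lintegral_smul_measure]
    exact lintegral_mono' (smul_restrict_ball_le_weighted measurableSet_ball (hball.trans hδΩ)
      fun w hw => hs w (hball hw)) le_rfl
  have h3 : ∫⁻ w, ‖v w ^ 2‖ₑ ∂(weighted Ω σ) = ENNReal.ofReal (bergmanNorm Ω σ v ^ 2) := by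
    rw [ENNReal.ofReal_pow (bergmanNorm_nonneg Ω σ v), bergmanNorm, ENNReal.ofReal_toReal hv.2.2.ne]
    have := eLpNorm_nnreal_pow_eq_lintegral (f := v) (μ := weighted Ω σ) (p := 2) two_ne_zero
    simp only [NNReal.coe_ofNat, ENNReal.rpow_ofNat, ENNReal.coe_ofNat] at this
    simp only [this, enorm_pow]
  have h4 : ENNReal.ofReal (c * ‖v z‖ ^ 2) ≤ ENNReal.ofReal (bergmanNorm Ω σ v ^ 2) := by
    rw [← h3]
    refine le_trans ?_ (le_trans (mul_le_mul_right h1 (ENNReal.ofReal s)) h2)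
    rw [hc, ENNReal.ofReal_mul (by positivity), ENNReal.ofReal_mul (by positivity), mul_assoc,
      enorm_pow, ENNReal.ofReal_pow (norm_nonneg _), ofReal_norm]
  rw [ENNReal.ofReal_le_ofReal_iff (by positivity)] at h4
  have h5 : ‖v z‖ ^ 2 ≤ c⁻¹ * bergmanNorm Ω σ v ^ 2 := by
    rw [inv_mul_eq_div, le_div_iff₀ hc0]; linarith
  calc ‖v z‖ = Real.sqrt (‖v z‖ ^ 2) := (Real.sqrt_sq (norm_nonneg _)).symm
    _ ≤ Real.sqrt (c⁻¹ * bergmanNorm Ω σ v ^ 2) := Real.sqrt_le_sqrt h5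
    _ = _ := by
      rw [Real.sqrt_mul (by positivity), Real.sqrt_sq (bergmanNorm_nonneg Ω σ v)]

/-- The Bergman space as a space of classes of square integrable functions. -/
noncomputable def bergmanToLp (Ω : Opens ℂ) (σ : ℂ → ℝ) :
    Bergman Ω σ →ₗ[ℂ] Lp ℂ 2 (weighted Ω σ) where
  toFun v := v.2.2.toLp
  map_add' _ _ := rfl
  map_smul' _ _ := rfl

theorem norm_bergmanToLp (σ : ℂ → ℝ) (v : Bergman Ω σ) :
    ‖bergmanToLp Ω σ v‖ = bergmanNorm Ω σ v := Lp.norm_toLp _ v.2.2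

theorem ae_mem_weighted (Ω : Opens ℂ) (σ : ℂ → ℝ) : ∀ᵐ z ∂(weighted Ω σ), z ∈ Ω :=
  (withDensity_absolutelyContinuous _ _).ae_le (ae_restrict_mem Ω.isOpen.measurableSet)

/-- A limit in `L²` of elements of the Bergman space is a locally uniform limit in `Ω`, hence
holomorphic. -/
theorem isClosed_range_bergmanToLp {σ : ℂ → ℝ} (hσ : ContinuousOn σ Ω)
    (hσ_pos : ∀ z ∈ Ω, 0 < σ z) :
    IsClosed ((LinearMap.range (bergmanToLp Ω σ) : Submodule ℂ (Lp ℂ 2 (weighted Ω σ))) :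
      Set (Lp ℂ 2 (weighted Ω σ))) := by
  refine isSeqClosed_iff_isClosed.mp fun w g hw hg => ?_
  choose v hv using hw
  have hcauchy : ∀ K : Set ℂ, K ⊆ Ω → IsCompact K →
      UniformCauchySeqOn (fun n => (v n : ℂ → ℂ)) atTop K := fun K hKΩ hK => by
    obtain ⟨C, hC, hCv⟩ := exists_norm_le_bergmanNorm hσ hσ_pos hK hKΩ
    rw [Metric.uniformCauchySeqOn_iff]
    intro ε hε
    obtain ⟨N, hN⟩ := Metric.cauchySeq_iff.mp hg.cauchySeq (ε / (C + 1)) (by positivity)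
    refine ⟨N, fun m hm n hn z hz => ?_⟩
    have h1 := hN m hm n hn
    have h2 := hCv _ (v m - v n).2 z hz
    rw [← norm_bergmanToLp, map_sub, hv, hv, ← dist_eq_norm] at h2
    rw [dist_eq_norm]
    have h3 : C * dist (w m) (w n) ≤ C * (ε / (C + 1)) := by gcongr
    have h4 : C * (ε / (C + 1)) < ε := by
      rw [mul_div_assoc', div_lt_iff₀ (by positivity)]; nlinarith
    exact lt_of_le_of_lt (h2.trans h3) h4
  have hpt : ∀ z : ℂ, ∃ y : ℂ, z ∈ Ω → Tendsto (fun n => (v n : ℂ → ℂ) z) atTop (𝓝 y) := fun z => by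
    by_cases hz : z ∈ Ω
    · obtain ⟨y, hy⟩ := cauchySeq_tendsto_of_complete
        ((hcauchy {z} (by simpa using hz) isCompact_singleton).cauchySeq rfl)
      exact ⟨y, fun _ => hy⟩
    · exact ⟨0, fun h => absurd h hz⟩
  choose f hf using hpt
  have hfd : DifferentiableOn ℂ f Ω := by
    refine TendstoLocallyUniformlyOn.differentiableOn (φ := atTop) (F := fun n => (v n : ℂ → ℂ)) ?_
      (Eventually.of_forall fun n => (v n).2.1) Ω.isOpen
    rw [tendstoLocallyUniformlyOn_iff_forall_isCompact Ω.isOpen]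
    exact fun K hKΩ hK => (hcauchy K hKΩ hK).tendstoUniformlyOn_of_tendsto
      fun z hz => hf z (hKΩ hz)
  obtain ⟨ns, hns, hae⟩ := (tendstoInMeasure_of_tendsto_Lp hg).exists_seq_tendsto_ae
  have hvw : ∀ᵐ z ∂(weighted Ω σ), ∀ n, w n z = (v n : ℂ → ℂ) z :=
    ae_all_iff.mpr fun n => by rw [← hv n]; exact (v n).2.2.coeFn_toLp
  have hfg : (g : ℂ → ℂ) =ᵐ[weighted Ω σ] f := by
    filter_upwards [hae, hvw, ae_mem_weighted Ω σ] with z h1 h2 h3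
    refine tendsto_nhds_unique h1 ?_
    simp only [h2]
    exact (hf z h3).comp hns.tendsto_atTop
  have hfm : MemLp f 2 (weighted Ω σ) := (memLp_congr_ae hfg).mp (Lp.memLp g)
  refine ⟨⟨f, hfd, hfm⟩, ?_⟩
  refine Lp.ext ?_
  exact hfm.coeFn_toLp.trans hfg.symm

/-- The Riesz representation theorem in the Bergman space. -/
theorem exists_bergman_representative {σ : ℂ → ℝ} (hσ : ContinuousOn σ Ω)
    (hσ_pos : ∀ z ∈ Ω, 0 < σ z) (ℓ : Bergman Ω σ →ₗ[ℂ] ℂ) {C : ℝ}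
    (hℓ : ∀ v, ‖ℓ v‖ ≤ C * bergmanNorm Ω σ v) :
    ∃ k : Bergman Ω σ, ∀ v : Bergman Ω σ,
      ℓ v = ∫ y, (v : ℂ → ℂ) y * conj ((k : ℂ → ℂ) y) ∂(weighted Ω σ) := by
  set ι := bergmanToLp Ω σ with hι
  have hker : LinearMap.ker ι ≤ LinearMap.ker ℓ := fun v hv => by
    rw [LinearMap.mem_ker] at hv ⊢
    have := hℓ v
    rw [← norm_bergmanToLp, ← hι, hv, norm_zero, mul_zero] at this
    exact norm_le_zero_iff.mp this
  -- `ℓ` as a functional on the range of `ι`, a closed subspace of `L²`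
  let L₀ : LinearMap.range ι →ₗ[ℂ] ℂ :=
    (LinearMap.ker ι).liftQ ℓ hker ∘ₗ ι.quotKerEquivRange.symm.toLinearMap
  have hL₀ : ∀ v (h : ι v ∈ LinearMap.range ι), L₀ ⟨ι v, h⟩ = ℓ v := fun v h => by
    simp only [L₀, LinearMap.comp_apply, LinearEquiv.coe_coe,
      LinearMap.quotKerEquivRange_symm_apply_image, Submodule.mkQ_apply, Submodule.liftQ_apply]
  let L : LinearMap.range ι →L[ℂ] ℂ := L₀.mkContinuous C fun w => by
    obtain ⟨w, hw⟩ := w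
    obtain ⟨v, rfl⟩ := LinearMap.mem_range.mp hw
    rw [hL₀]
    exact (hℓ v).trans_eq (by rw [← norm_bergmanToLp]; rfl)
  have : CompleteSpace (LinearMap.range ι) :=
    (isClosed_range_bergmanToLp hσ hσ_pos).completeSpace_coe
  obtain ⟨k, hk⟩ := ((InnerProductSpace.toDual ℂ (LinearMap.range ι)).symm L).2
  refine ⟨k, fun v => ?_⟩
  have h1 : ℓ v = inner ℂ ((InnerProductSpace.toDual ℂ (LinearMap.range ι)).symm L)
      (⟨ι v, v, rfl⟩ : LinearMap.range ι) := by
    rw [InnerProductSpace.toDual_symm_apply]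
    exact (hL₀ v _).symm
  rw [h1, Submodule.coe_inner, ← hk, L2.inner_def]
  refine integral_congr_ae ?_
  filter_upwards [v.2.2.coeFn_toLp, k.2.2.coeFn_toLp] with y hy hy'
  change inner ℂ (k.2.2.toLp (k : ℂ → ℂ) y) (v.2.2.toLp (v : ℂ → ℂ) y) = _
  rw [hy, hy']
  rfl

theorem isReproducingAt_reproducing {σ : ℂ → ℝ} (hσ : ContinuousOn σ Ω)
    (hσ_pos : ∀ z ∈ Ω, 0 < σ z) {x : ℂ} (hx : x ∈ Ω) :
    IsReproducingAt Ω σ x (reproducing Ω σ x) := by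
  have h : ∃ k, IsReproducingAt Ω σ x k := by
    obtain ⟨C, -, hCv⟩ := exists_norm_le_bergmanNorm hσ hσ_pos isCompact_singleton
      (Set.singleton_subset_iff.mpr hx)
    exact exists_bergman_representative hσ hσ_pos
      ((LinearMap.proj x : (ℂ → ℂ) →ₗ[ℂ] ℂ) ∘ₗ (Bergman Ω σ).subtype)
      fun v => hCv v v.2 x rfl
  rw [reproducing, dif_pos h]
  exact h.choose_spec

/-- Elements of the Bergman space as smooth functions. -/
def bergmanToSmooth (Ω : Opens ℂ) (σ : ℂ → ℝ) : Bergman Ω σ →ₗ[ℂ] smoothAlgebra Ω where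
  toFun v := ⟨v.1, smooth_of_mem_bergman v.2⟩
  map_add' _ _ := rfl
  map_smul' _ _ := rfl

/-- By Cauchy's estimates, compactly supported distributions are continuous on the Bergman
space. -/
theorem IsDistribution.exists_le_bergmanNorm {σ : ℂ → ℝ} (hσ : ContinuousOn σ Ω)
    (hσ_pos : ∀ z ∈ Ω, 0 < σ z) {Λ : smoothAlgebra Ω →ₗ[ℂ] ℂ} (h : IsDistribution Λ) :
    ∃ C : ℝ, ∀ v : Bergman Ω σ, ‖Λ (bergmanToSmooth Ω σ v)‖ ≤ C * bergmanNorm Ω σ v := by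
  obtain ⟨K, hK, hKΩ, N, C, hC, hΛ⟩ := h
  obtain ⟨δ, hδ, hδΩ⟩ := hK.exists_cthickening_subset_open Ω.isOpen hKΩ
  obtain ⟨B, hB0, hB⟩ := exists_norm_le_bergmanNorm hσ hσ_pos hK.cthickening hδΩ
  set D : ℝ := ∑ k ∈ Finset.range (N + 1), k.factorial * B / δ ^ k with hD
  have hDk : ∀ k ≤ N, (k.factorial * B / δ ^ k : ℝ) ≤ D := fun k hk =>
    Finset.single_le_sum (f := fun k : ℕ => (k.factorial * B / δ ^ k : ℝ))
      (fun _ _ => by positivity) (Finset.mem_range.mpr (Nat.lt_succ_iff.mpr hk))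
  have hD0 : 0 ≤ D := Finset.sum_nonneg fun _ _ => by positivity
  refine ⟨C * D, fun v => ?_⟩
  have hn := bergmanNorm_nonneg Ω σ v
  rw [mul_assoc]
  refine hΛ _ _ (by positivity) fun k hk z hz => ?_
  have hball : Metric.closedBall z δ ⊆ Metric.cthickening δ K :=
    Metric.closedBall_subset_cthickening hz δ
  calc _ ≤ ‖iteratedDeriv k (v : ℂ → ℂ) z‖ :=
        norm_iteratedFDeriv_le_of_differentiableOn Ω.isOpen k v.2.1 z (hKΩ hz)
    _ ≤ k.factorial * (B * bergmanNorm Ω σ v) / δ ^ k := by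
        refine Complex.norm_iteratedDeriv_le_of_forall_mem_sphere_norm_le k hδ ?_ fun w hw =>
          hB v v.2 w (hball (Metric.sphere_subset_closedBall hw))
        refine (v.2.1.mono ?_).diffContOnCl
        rw [closure_ball _ hδ.ne']
        exact hball.trans hδΩ
    _ = (k.factorial * B / δ ^ k) * bergmanNorm Ω σ v := by ring
    _ ≤ D * bergmanNorm Ω σ v := by gcongr; exact hDk k hk

/-- The kernel of the Toeplitz operator is contained in the kernel of the sesquilinear form
`(u, v) ↦ ⟨F, u conj v⟩`. The antilinear functional `v ↦ ⟨F, u conj v⟩` is represented by an element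
`k` of the Bergman space, and testing it on the reproducing kernels shows that `k = 0`. -/
theorem functional_mul_star_eq_zero {σ : ℂ → ℝ} (hσ : ContinuousOn σ Ω)
    (hσ_pos : ∀ z ∈ Ω, 0 < σ z) (F : CompactDistribution Ω) {u : Bergman Ω σ}
    (hu : toeplitz σ F u = 0) (v : Bergman Ω σ) :
    F.functional (bergmanToSmooth Ω σ u * star (bergmanToSmooth Ω σ v)) = 0 := by
  set Λ := conjFunctional F.functional ∘ₗ LinearMap.mulLeft ℂ (star (bergmanToSmooth Ω σ u))
    with hΛdef
  have hΛ : IsDistribution Λ := F.isDistribution.conj.mul_left _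
  have hΛv : ∀ v, Λ (bergmanToSmooth Ω σ v) =
      conj (F.functional (bergmanToSmooth Ω σ u * star (bergmanToSmooth Ω σ v))) := fun v => by
    simp [hΛdef, conjFunctional_apply, star_mul, mul_comm]
  obtain ⟨C, hC⟩ := hΛ.exists_le_bergmanNorm hσ hσ_pos
  obtain ⟨k, hk⟩ := exists_bergman_representative hσ hσ_pos (Λ ∘ₗ bergmanToSmooth Ω σ) hC
  have hk0 : ∀ x ∈ Ω, (k : ℂ → ℂ) x = 0 := fun x hx => by
    have h1 := hk (reproducing Ω σ x)
    have h2 : F.functional (bergmanToSmooth Ω σ u *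
        star (bergmanToSmooth Ω σ (reproducing Ω σ x))) = 0 := by
      rw [mul_comm]
      exact congrFun hu ⟨x, hx⟩
    rw [LinearMap.comp_apply, hΛv, h2, map_zero] at h1
    rw [isReproducingAt_reproducing hσ hσ_pos hx k, ← map_eq_zero_iff _ (starRingEnd ℂ).injective,
      ← integral_conj, h1]
    refine integral_congr_ae (Eventually.of_forall fun y => ?_)
    simp [mul_comm]
  have h3 := hk v
  rw [LinearMap.comp_apply, hΛv] at h3
  rw [← map_eq_zero_iff _ (starRingEnd ℂ).injective, h3]
  refine integral_eq_zero_of_ae ?_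
  filter_upwards [ae_mem_weighted Ω σ] with y hy
  simp [hk0 y hy]

/-! ### Bilinear forms of finite rank -/

/-- A bilinear form of finite rank is `∑ M(·, q_i) M(p_i, ·)` for biorthogonal systems `p`, `q`. -/
theorem exists_biorthogonal {V W : Type*} [AddCommGroup V] [Module ℂ V] (M : V →ₗ[ℂ] (W → ℂ))
    [FiniteDimensional ℂ (LinearMap.range M)] :
    ∃ (n : ℕ) (p : Fin n → V) (q : Fin n → W), (∀ i j, M (p j) (q i) = if i = j then 1 else 0) ∧
      ∀ u w, M u w = ∑ i, M u (q i) * M (p i) w := by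
  classical
  -- the evaluations at the points of `W` span the dual of the range of `M`; a basis chosen among
  -- them gives `q`, and its dual basis gives `p`
  let ev : W → Module.Dual ℂ (LinearMap.range M) :=
    fun w => (LinearMap.proj w : (W → ℂ) →ₗ[ℂ] ℂ) ∘ₗ (LinearMap.range M).subtype
  obtain ⟨b, hb, hspan, hli⟩ := exists_linearIndependent ℂ (Set.range ev)
  have htop : Submodule.span ℂ (Set.range ev) = ⊤ := by
    rw [← Subspace.dualCoannihilator_dualAnnihilator_eq (W := Submodule.span ℂ (Set.range ev))]
    have : (Submodule.span ℂ (Set.range ev)).dualCoannihilator = ⊥ := by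
      rw [eq_bot_iff]
      intro f hf
      rw [Submodule.mem_dualCoannihilator] at hf
      rw [Submodule.mem_bot]
      ext w
      exact hf (ev w) (Submodule.subset_span ⟨w, rfl⟩)
    rw [this, Submodule.dualAnnihilator_bot]
  let B₀ : Module.Basis b ℂ (Module.Dual ℂ (LinearMap.range M)) :=
    Module.Basis.mk hli (by rw [Subtype.range_coe, hspan, htop])
  have : Finite b := Module.Finite.finite_basis B₀
  obtain ⟨n, ⟨e⟩⟩ := Finite.exists_equiv_fin b
  let B := B₀.reindex e
  have hBev : ∀ i, ∃ w, ev w = B i := fun i => by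
    have h1 : B i = (e.symm i : Module.Dual ℂ (LinearMap.range M)) := by
      simp [B, B₀]
    rw [h1]
    exact hb (e.symm i).2
  choose q hq using hBev
  let c : Fin n → LinearMap.range M := fun j => (Module.evalEquiv ℂ _).symm (B.dualBasis j)
  have hc : ∀ i j, B i (c j) = if i = j then 1 else 0 := fun i j => by
    have h1 : Module.evalEquiv ℂ _ (c j) (B i) = B.dualBasis j (B i) := by
      simp only [c, LinearEquiv.apply_symm_apply]
    rw [B.dualBasis_apply_self] at h1
    exact h1
  choose p hp using fun j => (c j).2
  have hqr : ∀ i (f : LinearMap.range M), (f : W → ℂ) (q i) = B i f := fun i f => by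
    rw [← hq]; rfl
  refine ⟨n, p, q, fun i j => ?_, fun u w => ?_⟩
  · rw [hp, hqr, hc]
  · have hexp : ∀ f : LinearMap.range M, f = ∑ i, B i f • c i := fun f => by
      refine (Module.evalEquiv ℂ _).injective (B.ext fun j => ?_)
      change B j f = B j (∑ i, B i f • c i)
      rw [map_sum]
      simp [hc]
    have h1 := congrArg (fun f : LinearMap.range M => (f : W → ℂ) w) (hexp ⟨M u, u, rfl⟩)
    simp only at h1
    rw [h1, Submodule.coe_sum, Finset.sum_apply]
    refine Finset.sum_congr rfl fun i _ => ?_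
    rw [← hqr, Submodule.coe_smul, Pi.smul_apply, smul_eq_mul, hp]

/-! ### Entire functions of polynomial growth -/

theorem iteratedDeriv_eq_zero_of_growth {f : ℂ → ℂ} (hf : Differentiable ℂ f) {C : ℝ} {d n : ℕ}
    (hC : ∀ ζ, ‖f ζ‖ ≤ C * (1 + ‖ζ‖) ^ d) (hn : d < n) : iteratedDeriv n f 0 = 0 := by
  have hC0 : 0 ≤ C := by simpa using (norm_nonneg _).trans (hC 0)
  have hb : ∀ R : ℝ, 1 ≤ R → ‖iteratedDeriv n f 0‖ ≤ n.factorial * (C * 2 ^ d) * R⁻¹ := fun R hR => by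
    have hR0 : 0 < R := by linarith
    refine (Complex.norm_iteratedDeriv_le_of_forall_mem_sphere_norm_le (C := C * (2 * R) ^ d) n hR0
      hf.diffContOnCl fun z hz => (hC z).trans ?_).trans ?_
    · have : ‖z‖ = R := by simpa using hz
      rw [this]
      gcongr
      linarith
    · rw [div_le_iff₀ (by positivity), mul_pow]
      obtain ⟨k, rfl⟩ := Nat.exists_eq_add_of_lt hn
      have h1 : R ^ d ≤ R⁻¹ * R ^ (d + k + 1) := by
        rw [pow_succ, mul_comm (R ^ (d + k)), ← mul_assoc, inv_mul_cancel₀ hR0.ne', one_mul]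
        exact pow_le_pow_right₀ hR (by omega)
      calc ((d + k + 1).factorial : ℝ) * (C * (2 ^ d * R ^ d))
          = (d + k + 1).factorial * (C * 2 ^ d) * R ^ d := by ring
        _ ≤ (d + k + 1).factorial * (C * 2 ^ d) * (R⁻¹ * R ^ (d + k + 1)) := by gcongr
        _ = _ := by ring
  have ht : Tendsto (fun R : ℝ => n.factorial * (C * 2 ^ d) * R⁻¹) atTop (𝓝 0) := by
    simpa using tendsto_inv_atTop_zero.const_mul ((n.factorial : ℝ) * (C * 2 ^ d))
  exact norm_le_zero_iff.mp (ge_of_tendsto ht ((eventually_ge_atTop 1).mono hb))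

/-! ### Determinants as functionals on polynomials in several variables -/

open Polynomial

/-- For linear functionals `a_1, …, a_n` on `ℂ[X]`, the functional
`p_1(z_1) ⋯ p_n(z_n) ↦ det (a_i(p_j))` on polynomials in `n` variables. -/
noncomputable def detFunctional {n : ℕ} (a : Fin n → ℂ[X] →ₗ[ℂ] ℂ) :
    MvPolynomial (Fin n) ℂ →ₗ[ℂ] ℂ :=
  (MvPolynomial.basisMonomials (Fin n) ℂ).constr ℂ
    fun m => Matrix.det (Matrix.of fun j i => a i (X ^ m j))

section DetFunctional

variable {n : ℕ}

theorem detFunctional_monomial (a : Fin n → ℂ[X] →ₗ[ℂ] ℂ) (m : Fin n →₀ ℕ) :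
    detFunctional a (MvPolynomial.monomial m 1) =
      Matrix.det (Matrix.of fun j i => a i (X ^ m j)) :=
  (MvPolynomial.basisMonomials (Fin n) ℂ).constr_basis ℂ _ m

theorem detFunctional_prod (a : Fin n → ℂ[X] →ₗ[ℂ] ℂ) (p : Fin n → ℂ[X]) :
    detFunctional a (∏ j, aeval (MvPolynomial.X j) (p j)) =
      Matrix.det (Matrix.of fun j i => a i (p j)) := by
  have h : (detFunctional a).compMultilinearMap
      ((MultilinearMap.mkPiAlgebra ℂ (Fin n) (MvPolynomial (Fin n) ℂ)).compLinearMap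
        fun j => (aeval (R := ℂ) (MvPolynomial.X j : MvPolynomial (Fin n) ℂ)).toLinearMap) =
      (Matrix.detRowAlternating (n := Fin n) (R := ℂ)).toMultilinearMap.compLinearMap
        fun _ => LinearMap.pi a := by
    refine Module.Basis.ext_multilinear (fun _ => basisMonomials ℂ) fun v => ?_
    have h1 : ∏ j, (MvPolynomial.X j : MvPolynomial (Fin n) ℂ) ^ v j =
        MvPolynomial.monomial (Finsupp.equivFunOnFinite.symm v) 1 := by
      rw [MvPolynomial.monomial_eq, map_one, one_mul, Finsupp.prod_fintype _ _ (by simp)]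
      rfl
    simp only [LinearMap.compMultilinearMap_apply, MultilinearMap.compLinearMap_apply,
      MultilinearMap.mkPiAlgebra_apply, coe_basisMonomials, AlgHom.toLinearMap_apply,
      ← X_pow_eq_monomial, map_pow, aeval_X]
    rw [h1, detFunctional_monomial]
    rfl
  exact DFunLike.congr_fun h p

/-- Multiplication of the functionals by `X ^ k`, in the sense of Leibniz, corresponds to
multiplication by the `k`-th power sum. -/
theorem hasDerivAt_detFunctional {a : ℂ → Fin n → ℂ[X] →ₗ[ℂ] ℂ} {k : ℕ}
    (ha : ∀ i u ζ, HasDerivAt (fun ζ => a ζ i u) (a ζ i (u * X ^ k)) ζ)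
    (G : MvPolynomial (Fin n) ℂ) (ζ : ℂ) :
    HasDerivAt (fun ζ => detFunctional (a ζ) G)
      (detFunctional (a ζ) (MvPolynomial.psum (Fin n) ℂ k * G)) ζ := by
  induction G using MvPolynomial.induction_on' with
  | add p q hp hq =>
    simp only [map_add, mul_add]
    exact hp.add hq
  | monomial m c =>
    have hc : MvPolynomial.monomial m c = c • MvPolynomial.monomial m (1 : ℂ) := by
      rw [MvPolynomial.smul_monomial, smul_eq_mul, mul_one]
    rw [hc]
    simp only [mul_smul_comm, map_smul]
    refine HasDerivAt.const_smul c ?_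
    have hpsum : MvPolynomial.psum (Fin n) ℂ k * MvPolynomial.monomial m 1 =
        ∑ j, MvPolynomial.monomial (m + Finsupp.single j k) (1 : ℂ) := by
      rw [MvPolynomial.psum, Finset.sum_mul]
      refine Finset.sum_congr rfl fun j _ => ?_
      rw [MvPolynomial.X_pow_eq_monomial, MvPolynomial.monomial_mul, one_mul, add_comm]
    simp only [hpsum, map_sum, detFunctional_monomial, Matrix.det_apply, Matrix.of_apply]
    rw [Finset.sum_comm]
    refine HasDerivAt.fun_sum fun s _ => ?_
    rw [← Finset.smul_sum]
    refine HasDerivAt.fun_const_smul _ ?_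
    have hd := HasDerivAt.fun_finsetProd (u := Finset.univ) (x := ζ)
      (f := fun i ζ => a ζ i (X ^ m (s i))) (f' := fun i => a ζ i (X ^ m (s i) * X ^ k))
      fun i _ => ha i _ ζ
    refine hd.congr_deriv (Eq.symm ?_)
    rw [← Equiv.sum_comp s]
    refine Finset.sum_congr rfl fun i _ => ?_
    rw [← Finset.prod_erase_mul _ _ (Finset.mem_univ i), smul_eq_mul]
    congr 1
    · refine Finset.prod_congr rfl fun j hj => ?_
      have : s i ≠ s j := fun h => (Finset.ne_of_mem_erase hj) (s.injective h).symm
      simp [this]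
    · simp [pow_add]

theorem iteratedDeriv_detFunctional {a : ℂ → Fin n → ℂ[X] →ₗ[ℂ] ℂ} {k : ℕ}
    (ha : ∀ i u ζ, HasDerivAt (fun ζ => a ζ i u) (a ζ i (u * X ^ k)) ζ) (j : ℕ)
    (G : MvPolynomial (Fin n) ℂ) :
    iteratedDeriv j (fun ζ => detFunctional (a ζ) G) =
      fun ζ => detFunctional (a ζ) (MvPolynomial.psum (Fin n) ℂ k ^ j * G) := by
  induction j generalizing G with
  | zero => simp
  | succ j ih =>
    rw [iteratedDeriv_succ', show deriv (fun ζ => detFunctional (a ζ) G) = _ from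
      funext fun ζ => (hasDerivAt_detFunctional ha G ζ).deriv, ih]
    simp only [pow_succ, mul_assoc]

/-- If the determinants have polynomial growth of a fixed order after multiplication by one fixed
entire function `b` with `b 0 = 1`, then a monic polynomial in the power sum annihilates the
determinant functional: the derivatives of high order of the product vanish at `0`. -/
theorem exists_monic_psum_annihilates {a : ℂ → Fin n → ℂ[X] →ₗ[ℂ] ℂ} {k : ℕ}
    (ha : ∀ i u ζ, HasDerivAt (fun ζ => a ζ i u) (a ζ i (u * X ^ k)) ζ)
    {b : ℂ → ℂ} (hb : Differentiable ℂ b) (hb0 : b 0 = 1) (d : ℕ)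
    (hd : ∀ m : Fin n →₀ ℕ, ∃ C : ℝ, ∀ ζ,
      ‖detFunctional (a ζ) (MvPolynomial.monomial m 1) * b ζ‖ ≤ C * (1 + ‖ζ‖) ^ d) :
    ∃ π : ℂ[X], π.Monic ∧ ∀ G : MvPolynomial (Fin n) ℂ,
      detFunctional (a 0) (aeval (MvPolynomial.psum (Fin n) ℂ k) π * G) = 0 := by
  let π : ℂ[X] := ∑ j ∈ Finset.range (d + 2),
    C (((d + 1).choose j : ℂ) * iteratedDeriv (d + 1 - j) b 0) * X ^ j
  refine ⟨π, ?_, fun G => ?_⟩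
  · have h1 : π = X ^ (d + 1) + ∑ j ∈ Finset.range (d + 1),
        C (((d + 1).choose j : ℂ) * iteratedDeriv (d + 1 - j) b 0) * X ^ j := by
      simp only [π]
      rw [Finset.sum_range_succ, add_comm]
      simp [hb0]
    rw [h1]
    refine monic_X_pow_add (mem_degreeLT.mp (sum_mem fun j hj => mem_degreeLT.mpr ?_))
    exact (degree_C_mul_X_pow_le _ _).trans_lt (by exact_mod_cast Finset.mem_range.mp hj)
  · let T : MvPolynomial (Fin n) ℂ →ₗ[ℂ] ℂ := detFunctional (a 0) ∘ₗ
      LinearMap.mulLeft ℂ (aeval (MvPolynomial.psum (Fin n) ℂ k) π)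
    have hT : T = 0 := by
      refine (MvPolynomial.basisMonomials (Fin n) ℂ).ext fun m => ?_
      rw [MvPolynomial.coe_basisMonomials]
      obtain ⟨C, hC⟩ := hd m
      set G : MvPolynomial (Fin n) ℂ := MvPolynomial.monomial m 1
      have hdiff : Differentiable ℂ fun ζ => detFunctional (a ζ) G :=
        fun ζ => (hasDerivAt_detFunctional ha G ζ).differentiableAt
      have h0 := iteratedDeriv_eq_zero_of_growth (hdiff.mul hb) hC (Nat.lt_succ_self d)
      rw [iteratedDeriv_mul hdiff.contDiff.contDiffAt hb.contDiff.contDiffAt] at h0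
      simp only [iteratedDeriv_detFunctional ha] at h0
      rw [LinearMap.zero_apply, ← h0]
      simp only [T, π, LinearMap.comp_apply, LinearMap.mulLeft_apply, map_sum, map_mul, aeval_C,
        map_pow, aeval_X, Finset.sum_mul]
      refine Finset.sum_congr rfl fun j _ => ?_
      simp only [← Algebra.smul_def, smul_mul_assoc, map_smul, smul_eq_mul]
      ring
    exact DFunLike.congr_fun hT G

end DetFunctional

/-! ### Symmetric polynomials and integrality -/

/-- In characteristic zero, if all power sums are integral then so are the variables: Newton's
identities treat the elementary symmetric polynomials, of whose generating polynomial the variables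
are the roots. -/
theorem isIntegral_of_isIntegral_psum {n : ℕ} {Q : Type*} [CommRing Q] [Algebra ℂ Q]
    (f : MvPolynomial (Fin n) ℂ →ₐ[ℂ] Q)
    (h : ∀ k, IsIntegral ℂ (f (MvPolynomial.psum (Fin n) ℂ k))) (i : Fin n) :
    IsIntegral ℂ (f (MvPolynomial.X i)) := by
  have hneg : ∀ j : ℕ, IsIntegral ℂ ((-1 : Q) ^ j) := fun j => isIntegral_one.neg.pow j
  have hesymm : ∀ k, IsIntegral ℂ (f (MvPolynomial.esymm (Fin n) ℂ k)) := fun k => by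
    induction k using Nat.strong_induction_on with
    | _ k ih =>
      rcases Nat.eq_zero_or_pos k with rfl | hk
      · simpa using isIntegral_one
      · have h1 := congrArg f (MvPolynomial.mul_esymm_eq_sum (Fin n) ℂ k)
        simp only [map_mul, map_sum, map_pow, map_neg, map_one, map_natCast] at h1
        have h2 : IsIntegral ℂ ((k : Q) * f (MvPolynomial.esymm (Fin n) ℂ k)) := by
          rw [h1]
          refine (hneg _).mul (IsIntegral.sum _ fun x hx => ?_)
          exact ((hneg _).mul (ih _ (Finset.mem_filter.mp hx).2)).mul (h _)
        have h3 : f (MvPolynomial.esymm (Fin n) ℂ k) =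
            (k : ℂ)⁻¹ • ((k : Q) * f (MvPolynomial.esymm (Fin n) ℂ k)) := by
          have hk' : (k : ℂ) ≠ 0 := Nat.cast_ne_zero.mpr hk.ne'
          rw [← map_natCast (algebraMap ℂ Q), ← Algebra.smul_def, smul_smul, inv_mul_cancel₀ hk',
            one_smul]
        rw [h3]
        exact h2.smul _
  let S := integralClosure ℂ Q
  have hlift : ((∏ j : Fin n, (Polynomial.X + Polynomial.C (MvPolynomial.X j)) :
      Polynomial (MvPolynomial (Fin n) ℂ)).map (f : MvPolynomial (Fin n) ℂ →+* Q)) ∈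
      Polynomial.lifts (algebraMap S Q) := by
    rw [MvPolynomial.prod_C_add_X_eq_sum_esymm, Polynomial.map_sum]
    refine sum_mem fun j _ => ?_
    rw [Polynomial.map_mul, Polynomial.map_C, Polynomial.map_pow, Polynomial.map_X]
    exact mul_mem (Polynomial.C'_mem_lifts ⟨⟨_, hesymm j⟩, rfl⟩) (Polynomial.X_pow_mem_lifts _ _)
  obtain ⟨P, hP, -, hmonic⟩ := Polynomial.lifts_and_natDegree_eq_and_monic hlift
    (Polynomial.Monic.map _ (Polynomial.monic_prod_of_monic _ _ fun j _ =>
      Polynomial.monic_X_add_C _))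
  have hroot : IsIntegral S (-f (MvPolynomial.X i)) := by
    refine ⟨P, hmonic, ?_⟩
    rw [← Polynomial.eval_map, hP, Polynomial.map_prod, Polynomial.eval_prod]
    refine Finset.prod_eq_zero (Finset.mem_univ i) ?_
    simp
  have := (isIntegral_trans (R := ℂ) _ hroot).neg
  rwa [neg_neg] at this

/-- The elements `f` of an algebra which annihilate a linear functional `θ`, in the sense that
`θ (f g) = 0` for all `g`. -/
def annihilatorIdeal {R : Type*} [CommRing R] [Algebra ℂ R] (θ : R →ₗ[ℂ] ℂ) : Ideal R where
  carrier := {f | ∀ g, θ (f * g) = 0}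
  add_mem' := fun ha hb g => by rw [add_mul, map_add, ha g, hb g, add_zero]
  zero_mem' := fun g => by rw [zero_mul, map_zero]
  smul_mem' := fun c f hf g => by rw [smul_eq_mul, mul_comm c, mul_assoc]; exact hf _

theorem exists_monic_variable_annihilates {n : ℕ} (θ : MvPolynomial (Fin n) ℂ →ₗ[ℂ] ℂ)
    (h : ∀ k, ∃ π : Polynomial ℂ, π.Monic ∧ ∀ G,
      θ (Polynomial.aeval (MvPolynomial.psum (Fin n) ℂ k) π * G) = 0) (i : Fin n) :
    ∃ π : Polynomial ℂ, π.Monic ∧ ∀ G,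
      θ (Polynomial.aeval (MvPolynomial.X i : MvPolynomial (Fin n) ℂ) π * G) = 0 := by
  let f := Ideal.Quotient.mkₐ ℂ (annihilatorIdeal θ)
  obtain ⟨π, hπ, h0⟩ := isIntegral_of_isIntegral_psum f (fun k => by
    obtain ⟨π, hπ, h0⟩ := h k
    refine ⟨π, hπ, ?_⟩
    rw [← Polynomial.aeval_def, Polynomial.aeval_algHom_apply]
    exact Ideal.Quotient.eq_zero_iff_mem.mpr h0) i
  refine ⟨π, hπ, ?_⟩
  rw [← Polynomial.aeval_def, Polynomial.aeval_algHom_apply] at h0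
  exact Ideal.Quotient.eq_zero_iff_mem.mp h0

/-! ### Annihilating polynomials -/

/-- Holomorphic polynomials as smooth functions. -/
noncomputable def pol (Ω : Opens ℂ) : ℂ[X] →ₐ[ℂ] smoothAlgebra Ω := aeval (coord Ω)

theorem pol_X : pol Ω X = coord Ω := aeval_X _

theorem IsDistribution.sub {Λ₁ Λ₂ : smoothAlgebra Ω →ₗ[ℂ] ℂ} (h₁ : IsDistribution Λ₁)
    (h₂ : IsDistribution Λ₂) : IsDistribution (Λ₁ - Λ₂) := by
  rw [sub_eq_add_neg]
  exact h₁.add h₂.neg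

theorem IsDistribution.eq_zero_of_pol_exp {Λ : smoothAlgebra Ω →ₗ[ℂ] ℂ} (h : IsDistribution Λ)
    (hp : ∀ u, Λ (pol Ω u) = 0) (u g : ℂ[X]) : Λ (pol Ω u * expSmooth (pol Ω g)) = 0 := by
  refine (h.hasSum_exp (pol Ω u) (pol Ω g)).unique ?_
  simp only [← map_pow, ← map_mul, hp, mul_zero]
  exact hasSum_zero

/-- A factorization of the form `(u, w) ↦ ⟨Λ, u conj w⟩` on polynomials extends to products of
polynomials and exponentials of polynomials. -/
theorem IsDistribution.factorization_exp {Λ : smoothAlgebra Ω →ₗ[ℂ] ℂ} (hΛ : IsDistribution Λ)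
    {n : ℕ} {p q : Fin n → ℂ[X]}
    (hfac : ∀ u w, Λ (pol Ω u * star (pol Ω w)) =
      ∑ i, Λ (pol Ω u * star (pol Ω (q i))) * Λ (pol Ω (p i) * star (pol Ω w)))
    (u g w h : ℂ[X]) :
    Λ (pol Ω u * expSmooth (pol Ω g) * star (pol Ω w * expSmooth (pol Ω h))) =
      ∑ i, Λ (pol Ω u * expSmooth (pol Ω g) * star (pol Ω (q i))) *
        Λ (pol Ω (p i) * star (pol Ω w * expSmooth (pol Ω h))) := by
  -- extend the identity in the first argument, and then, by conjugation, in the second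
  have hfirst : ∀ w, Λ (pol Ω u * expSmooth (pol Ω g) * star (pol Ω w)) =
      ∑ i, Λ (pol Ω u * expSmooth (pol Ω g) * star (pol Ω (q i))) *
        Λ (pol Ω (p i) * star (pol Ω w)) := fun w => by
    have hD : IsDistribution (Λ ∘ₗ LinearMap.mulLeft ℂ (star (pol Ω w)) -
        ∑ i, Λ (pol Ω (p i) * star (pol Ω w)) •
          (Λ ∘ₗ LinearMap.mulLeft ℂ (star (pol Ω (q i))))) :=
      (hΛ.mul_left _).sub (IsDistribution.sum _ fun i _ => (hΛ.mul_left _).smul _)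
    have h0 := hD.eq_zero_of_pol_exp (fun v => by
      have := hfac v w
      simp only [LinearMap.sub_apply, LinearMap.comp_apply, LinearMap.mulLeft_apply,
        LinearMap.sum_apply, LinearMap.smul_apply, smul_eq_mul, mul_comm (star _) (pol Ω v), this]
      rw [sub_eq_zero]
      exact Finset.sum_congr rfl fun i _ => mul_comm _ _) u g
    simp only [LinearMap.sub_apply, LinearMap.comp_apply, LinearMap.mulLeft_apply,
      LinearMap.sum_apply, LinearMap.smul_apply, smul_eq_mul, sub_eq_zero] at h0
    rw [mul_comm, h0]
    exact Finset.sum_congr rfl fun i _ => by rw [mul_comm, mul_comm (star _)]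
  set U : smoothAlgebra Ω := pol Ω u * expSmooth (pol Ω g) with hU
  have hD : IsDistribution (conjFunctional (Λ ∘ₗ LinearMap.mulLeft ℂ U) -
      ∑ i, conj (Λ (U * star (pol Ω (q i)))) •
        conjFunctional (Λ ∘ₗ LinearMap.mulLeft ℂ (pol Ω (p i)))) :=
    (hΛ.mul_left _).conj.sub (IsDistribution.sum _ fun i _ => (hΛ.mul_left _).conj.smul _)
  have h0 := hD.eq_zero_of_pol_exp (fun v => by
    simp [conjFunctional_apply, hfirst v]) w h
  simp only [LinearMap.sub_apply, LinearMap.sum_apply, LinearMap.smul_apply, smul_eq_mul,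
    conjFunctional_apply, LinearMap.comp_apply, LinearMap.mulLeft_apply, ← map_mul, ← map_sum,
    ← map_sub] at h0
  rw [map_eq_zero_iff _ (starRingEnd ℂ).injective, sub_eq_zero] at h0
  exact h0

/-- If `⟨Λ, u conj w⟩` has finite rank then `Λ` is annihilated by a holomorphic polynomial. With
`h = z ^ k`, the determinant of `⟨Λ, z ^ (m_j) e^{ζh} conj (q_l e^{-ζh})⟩` has polynomial growth in
`ζ`, of an order which does not depend on `m`, and it is the product of `det ⟨Λ, z ^ (m_j) e^{ζh}
conj q_i⟩` and an antiholomorphic factor which does not depend on `m`. -/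
theorem IsDistribution.exists_pol_annihilates {Λ : smoothAlgebra Ω →ₗ[ℂ] ℂ}
    (hΛ : IsDistribution Λ) {n : ℕ} {p q : Fin n → ℂ[X]}
    (hδ : ∀ i j, Λ (pol Ω (p j) * star (pol Ω (q i))) = if i = j then 1 else 0)
    (hfac : ∀ u w, Λ (pol Ω u * star (pol Ω w)) =
      ∑ i, Λ (pol Ω u * star (pol Ω (q i))) * Λ (pol Ω (p i) * star (pol Ω w))) :
    ∃ π : ℂ[X], π ≠ 0 ∧ ∀ φ, Λ (pol Ω π * φ) = 0 := by
  obtain ⟨N, hN⟩ := hΛ.exists_polynomial_growth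
  let α : Fin n → ℂ[X] →ₗ[ℂ] ℂ := fun i =>
    Λ ∘ₗ LinearMap.mulLeft ℂ (star (pol Ω (q i))) ∘ₗ (pol Ω).toLinearMap
  have hα : ∀ i u, α i u = Λ (pol Ω u * star (pol Ω (q i))) := fun i u => by
    simp [α, mul_comm]
  have hpsum : ∀ k, ∃ π : ℂ[X], π.Monic ∧ ∀ G,
      detFunctional α (aeval (MvPolynomial.psum (Fin n) ℂ k) π * G) = 0 := fun k => by
    let a : ℂ → Fin n → ℂ[X] →ₗ[ℂ] ℂ := fun ζ i =>
      Λ ∘ₗ LinearMap.mulLeft ℂ (star (pol Ω (q i)) * expSmooth (ζ • pol Ω (X ^ k))) ∘ₗ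
        (pol Ω).toLinearMap
    have ha' : ∀ ζ i u, a ζ i u =
        Λ (star (pol Ω (q i)) * pol Ω u * expSmooth (ζ • pol Ω (X ^ k))) := fun ζ i u => by
      simp only [a, LinearMap.comp_apply, LinearMap.mulLeft_apply, AlgHom.toLinearMap_apply]
      rw [mul_right_comm]
    have ha0 : a 0 = α := by
      funext i
      refine LinearMap.ext fun u => ?_
      rw [ha', hα, zero_smul, expSmooth_zero, mul_one, mul_comm]
    have ha : ∀ i u ζ, HasDerivAt (fun ζ => a ζ i u) (a ζ i (u * X ^ k)) ζ := fun i u ζ => by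
      simp only [ha']
      rw [map_mul (pol Ω), ← mul_assoc (star _)]
      exact hΛ.hasDerivAt_exp _ _ ζ
    let β : ℂ → Matrix (Fin n) (Fin n) ℂ := fun ζ => Matrix.of fun i l =>
      Λ (pol Ω (p i) * star (pol Ω (q l) * expSmooth (ζ • -pol Ω (X ^ k))))
    -- the conjugate of an antiholomorphic factor, of the same modulus
    let b : ℂ → ℂ := fun ζ => conj (β ζ).det
    have hb : Differentiable ℂ b := by
      have h1 : b = fun ζ => Matrix.det (Matrix.of fun i l => conjFunctional Λ
          (star (pol Ω (p i)) * pol Ω (q l) * expSmooth (ζ • -pol Ω (X ^ k)))) := by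
        funext ζ
        simp only [b, β]
        rw [RingHom.map_det]
        congr 1
        ext i l
        simp [conjFunctional_apply, mul_assoc]
      rw [h1]
      simp only [Matrix.det_apply, Matrix.of_apply]
      refine Differentiable.fun_sum fun s _ => Differentiable.fun_const_smul ?_ _
      exact Differentiable.fun_finsetProd fun i _ ζ =>
        (hΛ.conj.hasDerivAt_exp _ _ ζ).differentiableAt
    have hb0 : b 0 = 1 := by
      have h1 : β 0 = 1 := by
        ext i l
        simp only [β, Matrix.of_apply, zero_smul, expSmooth_zero, mul_one, hδ, Matrix.one_apply]
        exact if_congr eq_comm rfl rfl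
      simp [b, h1]
    have hd : ∀ m : Fin n →₀ ℕ, ∃ C : ℝ, ∀ ζ,
        ‖detFunctional (a ζ) (MvPolynomial.monomial m 1) * b ζ‖ ≤
          C * (1 + ‖ζ‖) ^ (N * n) := fun m => by
      choose C hC using fun j l =>
        hN (pol Ω (X ^ m j) * star (pol Ω (q l))) (pol Ω (X ^ k))
      refine ⟨n.factorial • (∑ j, ∑ l, |C j l|) ^ n, fun ζ => ?_⟩
      have hprod : detFunctional (a ζ) (MvPolynomial.monomial m 1) * (β ζ).det =
          Matrix.det (Matrix.of fun j l => Λ (pol Ω (X ^ m j) * star (pol Ω (q l)) *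
            expSmooth (ζ • pol Ω (X ^ k) - star (ζ • pol Ω (X ^ k))))) := by
        rw [detFunctional_monomial, ← Matrix.det_mul]
        congr 1
        ext j l
        have h1 := hΛ.factorization_exp hfac (X ^ m j) (ζ • X ^ k) (q l) (ζ • -X ^ k)
        simp only [map_smul, map_neg] at h1
        rw [Matrix.mul_apply]
        simp only [Matrix.of_apply, ha', β]
        calc _ = ∑ i, Λ (pol Ω (X ^ m j) * expSmooth (ζ • pol Ω (X ^ k)) *
                star (pol Ω (q i))) * Λ (pol Ω (p i) * star (pol Ω (q l) *
                expSmooth (ζ • -pol Ω (X ^ k)))) := by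
              refine Finset.sum_congr rfl fun i _ => ?_
              congr 2
              ring
          _ = _ := by
              rw [← h1, star_mul, star_expSmooth, sub_eq_add_neg, expSmooth_add]
              congr 1
              rw [smul_neg, star_neg]
              ring
      rw [norm_mul, show ‖b ζ‖ = ‖(β ζ).det‖ from RCLike.norm_conj _, ← norm_mul, hprod]
      have h2 := Matrix.det_le (abv := IsAbsoluteValue.toAbsoluteValue (norm : ℂ → ℝ))
        (A := Matrix.of fun j l => Λ (pol Ω (X ^ m j) * star (pol Ω (q l)) *
            expSmooth (ζ • pol Ω (X ^ k) - star (ζ • pol Ω (X ^ k)))))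
        (x := (∑ j, ∑ l, |C j l|) * (1 + ‖ζ‖) ^ N) fun j l => by
          refine (hC j l ζ).trans ?_
          gcongr
          calc C j l ≤ |C j l| := le_abs_self _
            _ ≤ ∑ l, |C j l| := Finset.single_le_sum (f := fun l => |C j l|)
                (fun _ _ => abs_nonneg _) (Finset.mem_univ l)
            _ ≤ _ := Finset.single_le_sum (f := fun j => ∑ l, |C j l|)
                (fun _ _ => Finset.sum_nonneg fun _ _ => abs_nonneg _) (Finset.mem_univ j)
      refine le_trans h2 (le_of_eq ?_)
      rw [Fintype.card_fin, mul_pow, ← pow_mul, smul_mul_assoc]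
    have := exists_monic_psum_annihilates ha hb hb0 (N * n) hd
    rwa [ha0] at this
  choose π hmonic hπ using exists_monic_variable_annihilates (detFunctional α) hpsum
  have hαπ : ∀ i u, α i (π i * u) = 0 := fun i u => by
    -- replace the `i`-th of the polynomials `p_j` by `π_i u`
    have h1 := hπ i (∏ j, aeval (MvPolynomial.X j) (Function.update p i u j))
    have h2 : aeval (MvPolynomial.X i : MvPolynomial (Fin n) ℂ) (π i) *
        ∏ j, aeval (MvPolynomial.X j) (Function.update p i u j) =
        ∏ j, aeval (MvPolynomial.X j) (Function.update p i (π i * u) j) := by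
      rw [← Finset.mul_prod_erase _ _ (Finset.mem_univ i),
        ← Finset.mul_prod_erase Finset.univ
          (fun j => aeval (MvPolynomial.X j) (Function.update p i (π i * u) j))
          (Finset.mem_univ i), ← mul_assoc, Function.update_self, Function.update_self, map_mul]
      congr 1
      refine Finset.prod_congr rfl fun j hj => ?_
      rw [Function.update_of_ne (Finset.ne_of_mem_erase hj),
        Function.update_of_ne (Finset.ne_of_mem_erase hj)]
    rw [h2, detFunctional_prod] at h1
    have h3 : (Matrix.of fun j l => α l (Function.update p i (π i * u) j)) =
        (1 : Matrix (Fin n) (Fin n) ℂ).updateRow i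
          (∑ l, α l (π i * u) • (1 : Matrix (Fin n) (Fin n) ℂ) l) := by
      ext j l
      by_cases hj : j = i
      · subst hj
        simp [Finset.sum_apply, Matrix.one_apply]
      · rw [Matrix.updateRow_ne hj, Matrix.of_apply, Function.update_of_ne hj, hα, hδ,
          Matrix.one_apply]
        exact if_congr eq_comm rfl rfl
    rw [h3, Matrix.det_updateRow_sum, Matrix.det_one, smul_eq_mul, mul_one] at h1
    exact h1
  refine ⟨∏ i, π i, (monic_prod_of_monic _ _ fun i _ => hmonic i).ne_zero, ?_⟩
  have hzero : Λ ∘ₗ LinearMap.mulLeft ℂ (pol Ω (∏ i, π i)) = 0 := by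
    refine (hΛ.mul_left _).eq_zero_of_monomials fun j k => ?_
    have h1 : pol Ω (∏ i, π i) * (coord Ω ^ j * star (coord Ω) ^ k) =
        pol Ω ((∏ i, π i) * X ^ j) * star (pol Ω (X ^ k)) := by
      simp [pol_X, mul_assoc]
    rw [LinearMap.comp_apply, LinearMap.mulLeft_apply, h1, hfac]
    refine Finset.sum_eq_zero fun i _ => ?_
    rw [← hα, ← Finset.mul_prod_erase _ _ (Finset.mem_univ i), mul_assoc, hαπ, zero_mul]
  exact fun φ => DFunLike.congr_fun hzero φ

/-! ### Decomposition into distributions supported at points -/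

theorem pol_apply (p : ℂ[X]) (z : ℂ) : (pol Ω p : ℂ → ℂ) z = p.eval z := by
  induction p using Polynomial.induction_on' with
  | add p q hp hq =>
    rw [map_add, eval_add, ← hp, ← hq]
    rfl
  | monomial n c =>
    rw [← C_mul_X_pow_eq_monomial, map_mul, map_pow, pol_X, eval_mul, eval_C, eval_pow, eval_X,
      pol, aeval_C]
    rfl

/-- A function vanishing on `Ω` is killed, whatever its irrelevant values outside `Ω`. -/
theorem IsDistribution.eq_zero_of_eqOn {Λ : smoothAlgebra Ω →ₗ[ℂ] ℂ} (h : IsDistribution Λ)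
    {φ : smoothAlgebra Ω} (hφ : ∀ z ∈ Ω, (φ : ℂ → ℂ) z = 0) : Λ φ = 0 := by
  obtain ⟨K, -, hKΩ, N, C, -, hΛ⟩ := h
  refine norm_le_zero_iff.mp ((hΛ φ 0 le_rfl fun k _ z hz => ?_).trans_eq (mul_zero C))
  have h1 : (φ : ℂ → ℂ) =ᶠ[𝓝 z] fun _ => 0 := by
    filter_upwards [Ω.isOpen.mem_nhds (hKΩ hz)] with w hw using hφ w hw
  rw [(h1.iteratedFDeriv ℝ k).eq_of_nhds, iteratedFDeriv_fun_zero]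
  simp

/-- At every point one of `z - a` and `conj z - conj b` does not vanish. -/
theorem isCoprime_coord_star {a b : ℂ} (hab : a ≠ b) :
    IsCoprime (pol Ω (X - C a)) (star (pol Ω (X - C b))) := by
  have hD : ∀ z : ℂ, (z - a) * conj (z - a) + (z - b) * conj (z - b) ≠ 0 := fun z h => by
    rw [Complex.mul_conj, Complex.mul_conj, ← Complex.ofReal_add, Complex.ofReal_eq_zero] at h
    have h1 := Complex.normSq_nonneg (z - a)
    have h2 := Complex.normSq_nonneg (z - b)
    have h3 : z - a = 0 := Complex.normSq_eq_zero.mp (by linarith)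
    have h4 : z - b = 0 := Complex.normSq_eq_zero.mp (by linarith)
    exact hab (by linear_combination h4 - h3)
  let ψ : smoothAlgebra Ω :=
    ⟨fun z => ((z - a) * conj (z - a) + (z - b) * conj (z - b))⁻¹, by
      have h1 : ContDiff ℝ ∞ fun z : ℂ => conj z := Complex.conjCLE.contDiff
      refine ContDiffOn.inv (ContDiff.contDiffOn ?_) fun z _ => hD z
      simp only [map_sub]
      fun_prop⟩
  refine ⟨ψ * star (pol Ω (X - C a)), ψ * pol Ω (X - C b), ?_⟩
  ext z
  change (_ * conj ((pol Ω (X - C a) : ℂ → ℂ) z)) * (pol Ω (X - C a) : ℂ → ℂ) z +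
    (_ * (pol Ω (X - C b) : ℂ → ℂ) z) * conj ((pol Ω (X - C b) : ℂ → ℂ) z) = 1
  simp only [pol_apply, eval_sub, eval_X, eval_C]
  rw [mul_assoc, mul_assoc, ← mul_add, mul_comm (conj (z - a))]
  exact inv_mul_cancel₀ (hD z)

/-- The partial fraction decomposition of `1 / P`, multiplied by `P`. -/
theorem exists_partition {P : ℂ[X]} (hP : P ≠ 0) :
    ∃ (t : Finset ℂ) (e : ℂ → ℂ[X]) (m : ℂ → ℕ), ∑ a ∈ t, e a = 1 ∧
      ∀ a ∈ t, P ∣ e a * (X - C a) ^ m a := by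
  classical
  -- the point `0` makes the index set non-empty; the exponents at points other than roots are `0`
  obtain ⟨μ, hμ⟩ := (exists_sum_eq_one_iff_pairwise_coprime
    (s := fun a : ℂ => (X - C a) ^ P.roots.count a) (t := insert 0 P.roots.toFinset)
    (Finset.insert_nonempty _ _)).mpr fun a b hab =>
      (pairwise_coprime_X_sub_C Function.injective_id
        (fun h => hab (Subtype.ext h) : (a : ℂ) ≠ b)).pow
  refine ⟨_, _, fun a => P.roots.count a, hμ, fun a ha => ?_⟩
  rw [mul_assoc, ← Finset.erase_eq,
    Finset.prod_erase_mul _ (fun a : ℂ => (X - C a) ^ P.roots.count a) ha]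
  have h1 := (IsAlgClosed.splits P).eq_prod_roots
  rw [Finset.prod_multiset_map_count] at h1
  refine Dvd.dvd.mul_left ?_ _
  calc P ∣ ∏ a ∈ P.roots.toFinset, (X - C a) ^ P.roots.count a := by
        conv_lhs => rw [h1]
        exact (isUnit_C.mpr (leadingCoeff_ne_zero.mpr hP).isUnit).mul_left_dvd.mpr dvd_rfl
    _ ∣ _ := Finset.prod_dvd_prod_of_subset _ _ _ (Finset.subset_insert _ _)

/-- A distribution annihilated by `P` and by `conj P` is a sum of distributions
`⟨Λ, e_a conj e_a φ⟩` supported at the roots `a` of `P`, and `⟨Λ, e_a conj e_b φ⟩ = 0` for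
`a ≠ b`. -/
theorem exists_decomposition {Λ : smoothAlgebra Ω →ₗ[ℂ] ℂ} {P : ℂ[X]} (hP : P ≠ 0)
    (h₁ : pol Ω P ∈ annihilatorIdeal Λ) (h₂ : star (pol Ω P) ∈ annihilatorIdeal Λ) :
    ∃ (t : Finset ℂ) (e : ℂ → ℂ[X]) (m : ℂ → ℕ),
      (∀ φ, Λ φ = ∑ a ∈ t, Λ (pol Ω (e a) * star (pol Ω (e a)) * φ)) ∧
      (∀ a ∈ t, ∀ b ∈ t, a ≠ b → pol Ω (e a) * star (pol Ω (e b)) ∈ annihilatorIdeal Λ) ∧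
      ∀ a ∈ t,
        pol Ω (e a) * star (pol Ω (e a)) * pol Ω (X - C a) ^ m a ∈ annihilatorIdeal Λ ∧
        pol Ω (e a) * star (pol Ω (e a)) * star (pol Ω (X - C a)) ^ m a ∈ annihilatorIdeal Λ := by
  obtain ⟨t, e, m, hsum, hdvd⟩ := exists_partition hP
  have hd₁ : ∀ a ∈ t, pol Ω (e a) * pol Ω (X - C a) ^ m a ∈ annihilatorIdeal Λ := fun a ha => by
    obtain ⟨q, hq⟩ := hdvd a ha
    rw [← map_pow, ← map_mul, hq, map_mul]
    exact Ideal.mul_mem_right _ _ h₁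
  have hd₂ : ∀ a ∈ t, star (pol Ω (e a)) * star (pol Ω (X - C a)) ^ m a ∈
      annihilatorIdeal Λ := fun a ha => by
    obtain ⟨q, hq⟩ := hdvd a ha
    rw [← star_pow, ← star_mul', ← map_pow, ← map_mul, hq, map_mul, star_mul']
    exact Ideal.mul_mem_right _ _ h₂
  have hne : ∀ a ∈ t, ∀ b ∈ t, a ≠ b →
      pol Ω (e a) * star (pol Ω (e b)) ∈ annihilatorIdeal Λ := fun a ha b hb hab => by
    obtain ⟨x, y, hxy⟩ := (isCoprime_coord_star (Ω := Ω) hab).pow (m := m a) (n := m b)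
    have : pol Ω (e a) * star (pol Ω (e b)) =
        x * star (pol Ω (e b)) * (pol Ω (e a) * pol Ω (X - C a) ^ m a) +
        y * pol Ω (e a) * (star (pol Ω (e b)) * star (pol Ω (X - C b)) ^ m b) := by
      linear_combination -(pol Ω (e a) * star (pol Ω (e b))) * hxy
    rw [this]
    exact Ideal.add_mem _ (Ideal.mul_mem_left _ _ (hd₁ a ha)) (Ideal.mul_mem_left _ _ (hd₂ b hb))
  refine ⟨t, e, m, fun φ => ?_, hne, fun a ha => ⟨?_, ?_⟩⟩
  · have h1 : φ = ∑ a ∈ t, ∑ b ∈ t, pol Ω (e a) * star (pol Ω (e b)) * φ := by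
      simp only [← Finset.sum_mul, ← Finset.mul_sum, ← map_sum, ← star_sum, hsum, map_one,
        star_one, one_mul]
    conv_lhs => rw [h1]
    rw [map_sum]
    refine Finset.sum_congr rfl fun a ha => ?_
    rw [map_sum]
    exact Finset.sum_eq_single a (fun b hb hab => hne a ha b hb hab.symm φ) fun h => absurd ha h
  · rw [mul_right_comm]
    exact Ideal.mul_mem_right _ _ (hd₁ a ha)
  · rw [mul_assoc]
    exact Ideal.mul_mem_left _ _ (hd₂ a ha)

theorem IsDistribution.eq_zero_of_notMem {Λ : smoothAlgebra Ω →ₗ[ℂ] ℂ} (h : IsDistribution Λ)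
    {a : ℂ} (ha : a ∉ Ω) {m : ℕ} (hm : pol Ω (X - C a) ^ m ∈ annihilatorIdeal Λ) : Λ = 0 := by
  have hne : ∀ z ∈ Ω, (z - a) ^ m ≠ 0 := fun z hz =>
    pow_ne_zero _ (sub_ne_zero.mpr fun h => ha (h ▸ hz))
  ext φ
  let ψ : smoothAlgebra Ω := ⟨fun z => ((z - a) ^ m)⁻¹ * (φ : ℂ → ℂ) z,
    ((by fun_prop : ContDiff ℝ ∞ fun z : ℂ => (z - a) ^ m).contDiffOn.inv hne).mul φ.2⟩
  have h1 : Λ (φ - pol Ω (X - C a) ^ m * ψ) = 0 := h.eq_zero_of_eqOn fun z hz => by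
    change (φ : ℂ → ℂ) z - ((pol Ω (X - C a) : ℂ → ℂ) z) ^ m *
      (((z - a) ^ m)⁻¹ * (φ : ℂ → ℂ) z) = 0
    rw [pol_apply, eval_sub, eval_X, eval_C, mul_inv_cancel_left₀ (hne z hz), sub_self]
  rw [map_sub, hm ψ, sub_zero] at h1
  exact h1

/-! ### Distributions supported at a point -/

/-- Iterated directional derivatives are values of the iterated Fréchet derivative. -/
theorem exists_iterate_fderiv_eq {n : ℕ} {T : (ℂ → ℂ) → ℂ → ℂ} (v : ℂ) (hv : ‖v‖ ≤ 1)
    (hT : ∃ w : Fin n → ℂ, (∀ i, ‖w i‖ ≤ 1) ∧ ∀ φ : smoothAlgebra Ω, ∀ z ∈ Ω,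
      T φ z = iteratedFDeriv ℝ n (φ : ℂ → ℂ) z w) (k : ℕ) :
    ∃ w : Fin (n + k) → ℂ, (∀ i, ‖w i‖ ≤ 1) ∧ ∀ φ : smoothAlgebra Ω, ∀ z ∈ Ω,
      (fun f z => fderiv ℝ f z v)^[k] (T φ) z =
        iteratedFDeriv ℝ (n + k) (φ : ℂ → ℂ) z w := by
  induction k with
  | zero => exact hT
  | succ k ih =>
    obtain ⟨w, hw, h⟩ := ih
    refine ⟨Fin.cons v w, fun i => ?_, fun φ z hz => ?_⟩
    · refine Fin.cases hv hw i
    · rw [Function.iterate_succ_apply']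
      change _ = iteratedFDeriv ℝ (n + k + 1) (φ : ℂ → ℂ) z (Fin.cons v w)
      rw [iteratedFDeriv_succ_apply_left, Fin.cons_zero, Fin.tail_cons]
      have h1 : (fun f z => fderiv ℝ f z v)^[k] (T φ) =ᶠ[𝓝 z]
          fun z => iteratedFDeriv ℝ (n + k) (φ : ℂ → ℂ) z w := by
        filter_upwards [Ω.isOpen.mem_nhds hz] with y hy using h φ y hy
      have h2 : DifferentiableAt ℝ (iteratedFDeriv ℝ (n + k) (φ : ℂ → ℂ)) z :=
        (φ.2.contDiffAt (Ω.isOpen.mem_nhds hz)).differentiableAt_iteratedFDeriv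
          (by exact_mod_cast WithTop.coe_lt_top _)
      change fderiv ℝ _ z v = _
      rw [h1.fderiv_eq, fderiv_continuousMultilinear_apply_const_apply h2]

/-- `φ ↦ ∂_x^b ∂_y^c φ(a)` as a distribution. -/
theorem exists_isDistribution_partialDeriv {a : ℂ} (ha : a ∈ Ω) (b c : ℕ) :
    ∃ E : smoothAlgebra Ω →ₗ[ℂ] ℂ, IsDistribution E ∧
      ∀ φ, E φ = partialDeriv b c (φ : ℂ → ℂ) a := by
  obtain ⟨w, hw, h⟩ := exists_iterate_fderiv_eq (Ω := Ω) 1 (by simp)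
    (exists_iterate_fderiv_eq (Ω := Ω) (n := 0) (T := fun φ => φ) Complex.I (by simp)
      ⟨![], fun i => i.elim0, fun φ z _ => (iteratedFDeriv_zero_apply _).symm⟩ c) b
  have hs : ∀ φ : smoothAlgebra Ω, ContDiffAt ℝ ((0 + c + b : ℕ) : WithTop ℕ∞) (φ : ℂ → ℂ) a :=
    fun φ => (φ.2.contDiffAt (Ω.isOpen.mem_nhds ha)).of_le (by exact_mod_cast le_top)
  refine ⟨{ toFun := fun φ => iteratedFDeriv ℝ (0 + c + b) (φ : ℂ → ℂ) a w
            map_add' := fun φ ψ => ?_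
            map_smul' := fun r φ => ?_ },
    ⟨{a}, isCompact_singleton, by simpa using ha, 0 + c + b, 1, zero_le_one,
      fun φ M hM hφ => ?_⟩, fun φ => (h φ a ha).symm⟩
  · exact congrArg (· w) (iteratedFDeriv_add_apply (hs φ) (hs ψ))
  · exact congrArg (· w) (iteratedFDeriv_const_smul_apply (a := r) (hs φ))
  · refine (ContinuousMultilinearMap.le_of_opNorm_le (hφ _ le_rfl a rfl) w).trans ?_
    rw [one_mul]
    exact mul_le_of_le_one_right hM (Finset.prod_le_one (fun _ _ => norm_nonneg _) fun i _ => hw i)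

/-- `Re (z - a)` as a smooth function. -/
noncomputable def coordRe (Ω : Opens ℂ) (a : ℂ) : smoothAlgebra Ω :=
  (1 / 2 : ℂ) • (pol Ω (X - C a) + star (pol Ω (X - C a)))

/-- `Im (z - a)` as a smooth function. -/
noncomputable def coordIm (Ω : Opens ℂ) (a : ℂ) : smoothAlgebra Ω :=
  (-Complex.I / 2) • (pol Ω (X - C a) - star (pol Ω (X - C a)))

theorem coordRe_apply (a z : ℂ) : (coordRe Ω a : ℂ → ℂ) z = ((z - a).re : ℂ) := by
  change (1 / 2 : ℂ) * ((pol Ω (X - C a) : ℂ → ℂ) z + conj ((pol Ω (X - C a) : ℂ → ℂ) z)) = _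
  rw [pol_apply, eval_sub, eval_X, eval_C, Complex.re_eq_add_conj]
  ring

theorem coordIm_apply (a z : ℂ) : (coordIm Ω a : ℂ → ℂ) z = ((z - a).im : ℂ) := by
  change (-Complex.I / 2) * ((pol Ω (X - C a) : ℂ → ℂ) z - conj ((pol Ω (X - C a) : ℂ → ℂ) z)) = _
  rw [pol_apply, eval_sub, eval_X, eval_C, Complex.im_eq_sub_conj]
  field_simp
  rw [Complex.I_sq]
  ring

theorem polyAlgebra_le_adjoin (a : ℂ) :
    polyAlgebra Ω ≤ Algebra.adjoin ℂ {coordRe Ω a, coordIm Ω a} := by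
  have h1 : coordRe Ω a ∈ Algebra.adjoin ℂ {coordRe Ω a, coordIm Ω a} :=
    Algebra.subset_adjoin (by simp)
  have h2 : coordIm Ω a ∈ Algebra.adjoin ℂ {coordRe Ω a, coordIm Ω a} :=
    Algebra.subset_adjoin (by simp)
  rw [polyAlgebra, Algebra.adjoin_le_iff]
  rintro x (rfl | rfl)
  · have : coord Ω = coordRe Ω a + Complex.I • coordIm Ω a + algebraMap ℂ _ a := by
      ext z
      change z = (coordRe Ω a : ℂ → ℂ) z + Complex.I * (coordIm Ω a : ℂ → ℂ) z + a
      rw [coordRe_apply, coordIm_apply, mul_comm Complex.I, Complex.re_add_im, sub_add_cancel]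
    rw [this]
    exact add_mem (add_mem h1 (Subalgebra.smul_mem _ h2 _)) (Subalgebra.algebraMap_mem _ _)
  · have : star (coord Ω) = coordRe Ω a - Complex.I • coordIm Ω a + algebraMap ℂ _ (conj a) := by
      ext z
      change conj z = (coordRe Ω a : ℂ → ℂ) z - Complex.I * (coordIm Ω a : ℂ → ℂ) z + conj a
      rw [coordRe_apply, coordIm_apply]
      apply Complex.ext
      · simp
      · simp only [Complex.conj_im, Complex.sub_im, Complex.add_im, Complex.ofReal_im,
          Complex.I_mul_im, Complex.ofReal_re]
        ring
    rw [this]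
    exact add_mem (sub_mem h1 (Subalgebra.smul_mem _ h2 _)) (Subalgebra.algebraMap_mem _ _)

theorem partialDeriv_monomial (a : ℂ) (b c j k : ℕ) :
    partialDeriv b c (fun z : ℂ => (((z - a).re : ℂ)) ^ j * (((z - a).im : ℂ)) ^ k) =
      fun z => (j.descFactorial b * k.descFactorial c : ℂ) *
        ((((z - a).re : ℂ)) ^ (j - b) * (((z - a).im : ℂ)) ^ (k - c)) := by
  have hd : ∀ (v A : ℂ) (j k : ℕ) (z : ℂ), fderiv ℝ (fun z : ℂ => A * ((((z - a).re : ℂ)) ^ j *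
      (((z - a).im : ℂ)) ^ k)) z v = A * ((j * (((z - a).re : ℂ)) ^ (j - 1) * v.re) *
        (((z - a).im : ℂ)) ^ k +
        (((z - a).re : ℂ)) ^ j * (k * (((z - a).im : ℂ)) ^ (k - 1) * v.im)) := by
    intro v A j k z
    have h1 : HasFDerivAt (fun z : ℂ => (((z - a).re : ℝ) : ℂ))
        (Complex.ofRealCLM ∘L Complex.reCLM) z :=
      (Complex.ofRealCLM ∘L Complex.reCLM).hasFDerivAt.comp z ((hasFDerivAt_id z).sub_const a)
    have h2 : HasFDerivAt (fun z : ℂ => (((z - a).im : ℝ) : ℂ))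
        (Complex.ofRealCLM ∘L Complex.imCLM) z :=
      (Complex.ofRealCLM ∘L Complex.imCLM).hasFDerivAt.comp z ((hasFDerivAt_id z).sub_const a)
    have h3 : HasFDerivAt (fun z : ℂ => A * ((((z - a).re : ℂ)) ^ j * (((z - a).im : ℂ)) ^ k)) _ z :=
      ((h1.pow j).mul (h2.pow k)).const_mul A
    rw [h3.fderiv]
    simp
    ring
  have hI : ∀ c, (fun f (z : ℂ) => fderiv ℝ f z Complex.I)^[c]
      (fun z : ℂ => (((z - a).re : ℂ)) ^ j * (((z - a).im : ℂ)) ^ k) =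
      fun z => (k.descFactorial c : ℂ) *
        ((((z - a).re : ℂ)) ^ j * (((z - a).im : ℂ)) ^ (k - c)) := fun c => by
    induction c with
    | zero => simp
    | succ c ih =>
      rw [Function.iterate_succ_apply', ih]
      funext z
      rw [hd, Nat.descFactorial_succ, Nat.sub_sub]
      push_cast
      simp
      ring
  have h1 : ∀ (A : ℂ) (k b : ℕ), (fun f (z : ℂ) => fderiv ℝ f z 1)^[b]
      (fun z : ℂ => A * ((((z - a).re : ℂ)) ^ j * (((z - a).im : ℂ)) ^ k)) =
      fun z => (j.descFactorial b * A : ℂ) *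
        ((((z - a).re : ℂ)) ^ (j - b) * (((z - a).im : ℂ)) ^ k) := fun A k b => by
    induction b with
    | zero => simp
    | succ b ih =>
      rw [Function.iterate_succ_apply', ih]
      funext z
      rw [hd, Nat.descFactorial_succ, Nat.sub_sub]
      push_cast
      simp
      ring
  rw [partialDeriv, hI, h1]

theorem partialDeriv_monomial_self (a : ℂ) (b c j k : ℕ) :
    partialDeriv b c (fun z : ℂ => (((z - a).re : ℂ)) ^ j * (((z - a).im : ℂ)) ^ k) a =
      if b = j ∧ c = k then (b.factorial * c.factorial : ℂ) else 0 := by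
  rw [partialDeriv_monomial]
  split_ifs with h
  · obtain ⟨rfl, rfl⟩ := h
    simp [Nat.descFactorial_self]
  · rcases lt_trichotomy b j with h1 | h1 | h1
    · simp [zero_pow (Nat.sub_ne_zero_of_lt h1)]
    · rcases lt_trichotomy c k with h2 | h2 | h2
      · simp [zero_pow (Nat.sub_ne_zero_of_lt h2)]
      · exact absurd ⟨h1, h2⟩ h
      · simp [Nat.descFactorial_eq_zero_iff_lt.mpr h2]
    · simp [Nat.descFactorial_eq_zero_iff_lt.mpr h1]

theorem sub_pow_mem_of_pow_mem {R : Type*} [CommRing R] (I : Ideal R) {x y : R} {m n k : ℕ}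
    (hx : x ^ m ∈ I) (hy : y ^ n ∈ I) (hk : m + n ≤ k + 1) : (x - y) ^ k ∈ I := by
  rw [sub_eq_add_neg]
  refine Ideal.add_pow_mem_of_pow_mem_of_le _ hx (n := n) ?_ hk
  rw [neg_pow]
  exact Ideal.mul_mem_left _ _ hy

/-- A distribution annihilated by powers of `z - a` and of `conj (z - a)` is a combination of
derivatives of the point mass at `a`. -/
theorem IsDistribution.exists_eq_delta {Λ : smoothAlgebra Ω →ₗ[ℂ] ℂ} (h : IsDistribution Λ)
    {a : ℂ} (ha : a ∈ Ω) {m : ℕ} (h₁ : pol Ω (X - C a) ^ m ∈ annihilatorIdeal Λ)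
    (h₂ : star (pol Ω (X - C a)) ^ m ∈ annihilatorIdeal Λ) :
    ∃ L : DiffOp, ∀ φ, Λ φ = L.delta a (φ : ℂ → ℂ) := by
  classical
  set ξ := coordRe Ω a with hξ
  set η := coordIm Ω a with hη
  have hξm : ξ ^ (2 * m) ∈ annihilatorIdeal Λ := by
    rw [hξ, coordRe, Algebra.smul_def, mul_pow]
    exact Ideal.mul_mem_left _ _ (Ideal.add_pow_mem_of_pow_mem_of_le _ h₁ h₂ (by omega))
  have hηm : η ^ (2 * m) ∈ annihilatorIdeal Λ := by
    rw [hη, coordIm, Algebra.smul_def, mul_pow]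
    exact Ideal.mul_mem_left _ _ (sub_pow_mem_of_pow_mem _ h₁ h₂ (by omega))
  -- so only finitely many moments of `Λ` are non-zero, and these are the coefficients of `L`
  have hmon : ∀ j k, ¬ (j < 2 * m ∧ k < 2 * m) → Λ (ξ ^ j * η ^ k) = 0 := fun j k hjk => by
    by_cases hj : j < 2 * m
    · rw [mul_comm, ← Nat.add_sub_of_le (not_lt.mp fun hk => hjk ⟨hj, hk⟩), pow_add, mul_assoc]
      exact hηm _
    · rw [← Nat.add_sub_of_le (not_lt.mp hj), pow_add, mul_assoc]
      exact hξm _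
  choose E hE hEφ using fun bc : ℕ × ℕ => exists_isDistribution_partialDeriv ha bc.1 bc.2
  let B : Finset (ℕ × ℕ) := Finset.range (2 * m) ×ˢ Finset.range (2 * m)
  let γ : ℕ × ℕ → ℂ := fun bc => Λ (ξ ^ bc.1 * η ^ bc.2) / (bc.1.factorial * bc.2.factorial)
  have hzero : Λ - ∑ bc ∈ B, γ bc • E bc = 0 := by
    have hD : IsDistribution (Λ - ∑ bc ∈ B, γ bc • E bc) :=
      h.sub (IsDistribution.sum _ fun bc _ => (hE bc).smul _)
    refine hD.eq_zero_of_polyAlgebra fun P hP =>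
      eq_zero_on_adjoin_pair _ (fun j k => ?_) P (polyAlgebra_le_adjoin a hP)
    have hfun : ((ξ ^ j * η ^ k : smoothAlgebra Ω) : ℂ → ℂ) =
        fun z : ℂ => (((z - a).re : ℂ)) ^ j * (((z - a).im : ℂ)) ^ k := by
      funext z
      change ((ξ : ℂ → ℂ) z) ^ j * ((η : ℂ → ℂ) z) ^ k = _
      rw [hξ, hη, coordRe_apply, coordIm_apply]
    have h1 : ∀ bc : ℕ × ℕ, γ bc * E bc (ξ ^ j * η ^ k) =
        if bc = (j, k) then Λ (ξ ^ j * η ^ k) else 0 := fun ⟨b, c⟩ => by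
      rw [hEφ, hfun, partialDeriv_monomial_self]
      simp only [Prod.mk.injEq]
      split_ifs with hbc
      · obtain ⟨rfl, rfl⟩ := hbc
        exact div_mul_cancel₀ _ (mul_ne_zero (Nat.cast_ne_zero.mpr b.factorial_ne_zero)
          (Nat.cast_ne_zero.mpr c.factorial_ne_zero))
      · exact mul_zero _
    have h2 : ∑ bc ∈ B, γ bc * E bc (ξ ^ j * η ^ k) =
        if (j, k) ∈ B then Λ (ξ ^ j * η ^ k) else 0 := by
      rw [Finset.sum_congr rfl fun bc _ => h1 bc, Finset.sum_ite_eq']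
    rw [LinearMap.sub_apply, LinearMap.sum_apply]
    refine (congrArg (Λ (ξ ^ j * η ^ k) - ·) h2).trans ?_
    split_ifs with hjk
    · exact sub_self _
    · rw [hmon j k fun hh => hjk (by simpa [B] using hh), sub_zero]
  refine ⟨Finsupp.onFinset B
    (fun bc => if bc ∈ B then (-1) ^ (bc.1 + bc.2) * γ bc else 0) (fun bc hbc => by
      by_contra hB
      exact hbc (if_neg hB)), fun φ => ?_⟩
  rw [DiffOp.delta, Finsupp.onFinset_sum _ fun _ => by simp, sub_eq_zero.mp hzero,
    LinearMap.sum_apply]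
  refine Finset.sum_congr rfl fun bc hbc => ?_
  rw [if_pos hbc, LinearMap.smul_apply, smul_eq_mul, hEφ, mul_right_comm ((-1 : ℂ) ^ _), ← mul_pow]
  norm_num

/-! ### Toeplitz operators of finite rank -/

/-- Polynomials as elements of the Bergman space. -/
noncomputable def polyToBergman {σ : ℂ → ℝ}
    (hpoly : ∀ n : ℕ, MemLp (fun z : ℂ => z ^ n) 2 (weighted Ω σ)) :
    ℂ[X] →ₗ[ℂ] Bergman Ω σ where
  toFun p := ⟨fun z => p.eval z, p.differentiable.differentiableOn, by
    simp only [eval_eq_sum_range]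
    exact memLp_finsetSum _ fun i _ => (hpoly i).const_mul _⟩
  map_add' p q := by ext z; exact eval_add
  map_smul' c p := by ext z; exact eval_smul ..

theorem bergmanToSmooth_polyToBergman {σ : ℂ → ℝ}
    (hpoly : ∀ n : ℕ, MemLp (fun z : ℂ => z ^ n) 2 (weighted Ω σ)) (p : ℂ[X]) :
    bergmanToSmooth Ω σ (polyToBergman hpoly p) = pol Ω p := by
  ext z
  exact (pol_apply p z).symm

/-- The form `(u, w) ↦ ⟨Λ, u conj w⟩` on polynomials. -/
noncomputable def polyForm (Λ : smoothAlgebra Ω →ₗ[ℂ] ℂ) : ℂ[X] →ₗ[ℂ] (ℂ[X] → ℂ) :=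
  LinearMap.pi fun w => Λ ∘ₗ LinearMap.mulLeft ℂ (star (pol Ω w)) ∘ₗ (pol Ω).toLinearMap

theorem polyForm_apply (Λ : smoothAlgebra Ω →ₗ[ℂ] ℂ) (u w : ℂ[X]) :
    polyForm Λ u w = Λ (pol Ω u * star (pol Ω w)) := by
  rw [mul_comm]
  rfl

theorem finiteDimensional_range_of_ker_le {V W₁ W₂ : Type*} [AddCommGroup V] [Module ℂ V]
    [AddCommGroup W₁] [Module ℂ W₁] [AddCommGroup W₂] [Module ℂ W₂] {f : V →ₗ[ℂ] W₁}
    {g : V →ₗ[ℂ] W₂} [FiniteDimensional ℂ (LinearMap.range f)]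
    (h : LinearMap.ker f ≤ LinearMap.ker g) : FiniteDimensional ℂ (LinearMap.range g) := by
  have : FiniteDimensional ℂ (V ⧸ LinearMap.ker f) :=
    Module.Finite.equiv f.quotKerEquivRange.symm
  rw [← Submodule.range_liftQ _ g h]
  infer_instance

/-- If the form `⟨Λ, u conj w⟩` on polynomials has finite rank, then `Λ` is annihilated by a
polynomial and by the conjugate of it. -/
theorem IsDistribution.exists_pol_mem_annihilatorIdeal {Λ : smoothAlgebra Ω →ₗ[ℂ] ℂ}
    (h : IsDistribution Λ) [FiniteDimensional ℂ (LinearMap.range (polyForm Λ))] :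
    ∃ P : ℂ[X], P ≠ 0 ∧ pol Ω P ∈ annihilatorIdeal Λ ∧ star (pol Ω P) ∈ annihilatorIdeal Λ := by
  obtain ⟨n, p, q, hδ, hfac⟩ := exists_biorthogonal (polyForm Λ)
  simp only [polyForm_apply] at hδ hfac
  obtain ⟨π₁, hπ₁, h₁⟩ := h.exists_pol_annihilates hδ hfac
  have hconj : ∀ u w, conjFunctional Λ (pol Ω u * star (pol Ω w)) =
      conj (Λ (pol Ω w * star (pol Ω u))) := fun u w => by
    rw [conjFunctional_apply, star_mul, star_star]
  obtain ⟨π₂, hπ₂, h₂⟩ := h.conj.exists_pol_annihilates (p := q) (q := p) (fun i j => by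
    rw [hconj, hδ]
    rw [apply_ite conj, map_one, map_zero]
    exact if_congr eq_comm rfl rfl) fun u w => by
    simp only [hconj, ← map_mul, ← map_sum, hfac w u, mul_comm]
  refine ⟨π₁ * π₂, mul_ne_zero hπ₁ hπ₂, ?_, ?_⟩
  · rw [map_mul]
    exact Ideal.mul_mem_right _ _ h₁
  · rw [map_mul, star_mul]
    refine Ideal.mul_mem_right _ _ fun φ => ?_
    have h3 := h₂ (star φ)
    rwa [conjFunctional_apply, star_mul, star_star, map_eq_zero_iff _ (starRingEnd ℂ).injective,
      mul_comm] at h3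

/-- A system which is biorthogonal for the form bounds the rank from below. -/
theorem card_le_rank_of_orthogonal {V W Z : Type*} [AddCommGroup V] [Module ℂ V]
    [AddCommGroup W] [Module ℂ W] {T : V →ₗ[ℂ] W} {M : V →ₗ[ℂ] (Z → ℂ)}
    (hker : LinearMap.ker T ≤ LinearMap.ker M) {ι : Type*} (s : Finset ι) {p : ι → V} {q : ι → Z}
    (hne : ∀ a ∈ s, M (p a) (q a) ≠ 0)
    (hort : ∀ a ∈ s, ∀ b ∈ s, a ≠ b → M (p a) (q b) = 0) : (s.card : Cardinal) ≤ T.rank := by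
  have hli : LinearIndependent ℂ fun a : s => T.rangeRestrict (p a) := by
    rw [Fintype.linearIndependent_iff]
    intro g hg b
    have h1 : T (∑ a, g a • p a) = 0 := by
      have := congrArg (LinearMap.range T).subtype hg
      simpa [map_sum] using this
    have h2 : M (∑ a, g a • p a) = 0 := hker h1
    have h3 := congrFun h2 (q b)
    rw [map_sum, Finset.sum_apply, Finset.sum_eq_single b] at h3
    · simpa [hne b b.2] using h3
    · intro a _ hab
      rw [map_smul, Pi.smul_apply, hort a a.2 b b.2 (fun h => hab (Subtype.ext h)), smul_zero]
    · simp
  have := hli.cardinal_lift_le_rank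
  simpa using this

/-- The theorem for functionals on the algebra `C^∞(Ω)`. -/
theorem exists_sum_delta {σ : ℂ → ℝ} (hσ : ContinuousOn σ Ω) (hσ_pos : ∀ z ∈ Ω, 0 < σ z)
    (hpoly : ∀ n : ℕ, MemLp (fun z : ℂ => z ^ n) 2 (weighted Ω σ))
    (F : CompactDistribution Ω) {r : ℕ} (hr : (toeplitz σ F).rank = r) :
    ∃ (s : Finset ℂ) (L : ℂ → DiffOp), s.card ≤ r ∧ (s : Set ℂ) ⊆ Ω ∧
      ∀ φ, F.functional φ = ∑ w ∈ s, (L w).delta w (φ : ℂ → ℂ) := by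
  classical
  set Λ := F.functional with hΛdef
  have hΛ : IsDistribution Λ := F.isDistribution
  set T := toeplitz σ F ∘ₗ polyToBergman hpoly with hT
  have hrank : T.rank ≤ r := hr ▸ LinearMap.rank_comp_le_left _ _
  have hker : LinearMap.ker T ≤ LinearMap.ker (polyForm Λ) := fun u hu => by
    rw [LinearMap.mem_ker] at hu ⊢
    funext w
    rw [polyForm_apply, ← bergmanToSmooth_polyToBergman hpoly u,
      ← bergmanToSmooth_polyToBergman hpoly w]
    exact functional_mul_star_eq_zero hσ hσ_pos F hu _
  have : FiniteDimensional ℂ (LinearMap.range T) :=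
    Module.rank_lt_aleph0_iff.mp (hrank.trans_lt Cardinal.natCast_lt_aleph0)
  have := finiteDimensional_range_of_ker_le hker
  obtain ⟨P, hP, h₁, h₂⟩ := hΛ.exists_pol_mem_annihilatorIdeal
  obtain ⟨t, e, m, hsum, hort, hann⟩ := exists_decomposition hP h₁ h₂
  let Λ' : ℂ → smoothAlgebra Ω →ₗ[ℂ] ℂ := fun a =>
    Λ ∘ₗ LinearMap.mulLeft ℂ (pol Ω (e a) * star (pol Ω (e a)))
  have hΛ' : ∀ a, IsDistribution (Λ' a) := fun a => hΛ.mul_left _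
  have hann₁ : ∀ a ∈ t, pol Ω (X - C a) ^ m a ∈ annihilatorIdeal (Λ' a) := fun a ha φ => by
    rw [LinearMap.comp_apply, LinearMap.mulLeft_apply, ← mul_assoc]
    exact (hann a ha).1 φ
  have hann₂ : ∀ a ∈ t, star (pol Ω (X - C a)) ^ m a ∈ annihilatorIdeal (Λ' a) :=
    fun a ha φ => by
      rw [LinearMap.comp_apply, LinearMap.mulLeft_apply, ← mul_assoc]
      exact (hann a ha).2 φ
  let s : Finset ℂ := t.filter fun a => Λ' a ≠ 0
  have hst : ∀ a ∈ s, a ∈ t ∧ Λ' a ≠ 0 := fun a ha => Finset.mem_filter.mp ha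
  have hsΩ : ∀ a ∈ s, a ∈ Ω := fun a ha => by
    by_contra h
    exact (hst a ha).2 ((hΛ' a).eq_zero_of_notMem h (hann₁ a (hst a ha).1))
  have hL : ∀ a, ∃ L : DiffOp, a ∈ s → ∀ φ, Λ' a φ = L.delta a (φ : ℂ → ℂ) := fun a => by
    by_cases ha : a ∈ s
    · obtain ⟨L, hL⟩ := (hΛ' a).exists_eq_delta (hsΩ a ha) (hann₁ a (hst a ha).1)
        (hann₂ a (hst a ha).1)
      exact ⟨L, fun _ => hL⟩
    · exact ⟨0, fun h => absurd h ha⟩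
  choose L hL using hL
  have hmon : ∀ a, ∃ jk : ℕ × ℕ, a ∈ s → Λ' a (coord Ω ^ jk.1 * star (coord Ω) ^ jk.2) ≠ 0 :=
    fun a => by
      by_contra! h
      exact (hst a (h (0, 0)).1).2 ((hΛ' a).eq_zero_of_monomials fun j k => (h (j, k)).2)
  choose jk hjk using hmon
  have hprod : ∀ a b, polyForm Λ (e a * X ^ (jk a).1) (e b * X ^ (jk b).2) =
      Λ (pol Ω (e a) * star (pol Ω (e b)) *
        (coord Ω ^ (jk a).1 * star (coord Ω) ^ (jk b).2)) := fun a b => by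
    rw [polyForm_apply, map_mul (pol Ω), map_mul (pol Ω), map_pow, map_pow, pol_X, star_mul',
      star_pow, mul_mul_mul_comm]
  refine ⟨s, L, ?_, hsΩ, fun φ => ?_⟩
  · have h1 := card_le_rank_of_orthogonal hker s (p := fun a => e a * X ^ (jk a).1)
      (q := fun a => e a * X ^ (jk a).2)
      (fun a ha => by rw [hprod]; exact hjk a ha)
      fun a ha b hb hab => by
        rw [hprod]; exact hort a (hst a ha).1 b (hst b hb).1 hab _
    exact_mod_cast h1.trans hrank
  · rw [hsum φ]
    calc _ = ∑ a ∈ t, Λ' a φ := rfl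
      _ = ∑ a ∈ s, Λ' a φ := (Finset.sum_subset (Finset.filter_subset _ _) fun a ha has => by
          by_contra h
          exact has (Finset.mem_filter.mpr ⟨ha, fun h0 => h (by rw [h0, LinearMap.zero_apply])⟩)).symm
      _ = _ := Finset.sum_congr rfl fun a ha => hL a ha φ

end FiniteRankToeplitz

theorem theorem3 (Ω : TopologicalSpace.Opens ℂ) (hΩ : IsConnected (Ω : Set ℂ))
    (σ : ℂ → ℝ) (hσ : ContinuousOn σ Ω) (hσ_pos : ∀ z ∈ Ω, 0 < σ z)
    (hpoly : ∀ n : ℕ, MeasureTheory.MemLp (fun z : ℂ => z ^ n) 2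
      (FiniteRankToeplitz.weighted Ω σ))
    (F : FiniteRankToeplitz.CompactDistribution Ω) (r : ℕ)
    (hr : (FiniteRankToeplitz.toeplitz σ F).rank = r) :
    ∃ (s : Finset ℂ) (L : ℂ → FiniteRankToeplitz.DiffOp),
      s.card ≤ r ∧ (s : Set ℂ) ⊆ Ω ∧
      ∀ φ : FiniteRankToeplitz.Smooth Ω,
        F.toLinearMap φ = ∑ w ∈ s, (L w).delta w (φ : ℂ → ℂ) := by
  obtain ⟨s, L, hs, hsΩ, h⟩ := FiniteRankToeplitz.exists_sum_delta hσ hσ_pos hpoly F hr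
  exact ⟨s, L, hs, hsΩ, fun φ => h ⟨φ.1, φ.2⟩⟩
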